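/- **Setting.** Let $T=(V,E)$ be a finite tree with $n$ vertices, $P$ a set of pebbles and $H$ a set of holes with $|P|+|H|=n$. A (valid) configuration is a bijection $\mathcal A:P\sqcup H\to V$. A move $u\to v$ along an edge is allowed iff $v$ is occupied by a hole; it exchanges the occupants of $u$ and $v$. A plan is a finite sequence of moves, feasible if each move is allowed when it is made; its length is its number of moves. For $a,b\in V$ let $\pi_{ab}$ be the path (and its vertex set) from $a$ to $b$, $d(a,b)$ its length, $d(a,W)=\min_{w\in W}d(a,w)$; a junction is a vertex of degree $>2$. For $v\neq u$ let $T(F(u),v)$ be the component of $T-u$ containing $v$. A corridor is a path whose end nodes have degree $\ne 2$ and whose internal nodes have degree $2$; $c_1$ is the maximum length of a corridor and $c_2$ the maximum length of a corridor whose end nodes are junctions ($0$ if there is none). Put $c=c_1$ if $T$ is a path graph (two nodes of degree $1$, all others of degree $2$), and $c=\max\{c_1+1,c_2+2\}$ otherwise. A subset of $X$ of cardinality $q$ closest to $B$ is a minimizer of $\sum_{a\in W}d(a,B)$ over $W\subseteq X$, $|W|=q$. Ties and unspecified choices below are resolved arbitrarily. *Gathering holes in $B$ within a subtree $X\supseteq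 B$.* Let $M$ be a subset of cardinality $|B|$, closest to $B$, of the vertices of $X$ occupied by holes. Let $\bar H$ be the set of holes on $M\setminus B$ and $B_P$ the set of vertices of $B$ occupied by pebbles. While $B_P\neq\emptyset$: choose $h\in\bar H$, located at $v$, a vertex $u\in B_P$ closest to $v$, and the vertex $w$ of $\pi_{uv}\cap B$ closest to $v$; move the pebble on $u$ along $\pi_{uw}$ to $w$; bring the hole from $v$ to $w$ by performing the moves of $\pi_{wv}$ towards $v$, the one nearest to $v$ first; remove $h$ from $\bar H$ and $u$ from $B_P$. *Procedure A* (marked pebble on $r$, target $t\ne r$). Let $\ell_0=r$ and let $i_0$ be the neighbour of $r$ on $\pi_{rt}$. For $k=0,1,\dots$: if $d(i_k,t)\le c-1$, put $j_k=t$, $m=k$ and stop; otherwise let $j_k$ be the node of $\pi_{i_kt}$ with $d(i_k,j_k)=c-2$, let $i_{k+1}$ be the junction closest to $j_k$ on $\pi_{j_{k-1}j_k}\setminus\{j_{k-1}\}$ (with $j_{-1}=i_0$), and let $\ell_{k+1}$ be a neighbour of $i_{k+1}$ not on $\pi_{rt}$. Let $S_k=\pi_{i_kj_k}\cup\{\ell_k,\ell_{k+1}\}$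 for $k<m$ and $S_m=\pi_{i_mj_m}\cup\{\ell_m\}$. Gather holes in $S_0\setminus\{\ell_0\}$ within $T(F(r),t)$ and move the marked pebble from $\ell_0$ to $\ell_1$ (to $t$ if $m=0$). Then for $k=0,\dots,m-1$ gather holes in $S_{k+1}\setminus\{\ell_{k+1}\}$ within $(S_k\cup S_{k+1})\setminus\{\ell_{k+1}\}$, and move the marked pebble from $\ell_{k+1}$ to $\ell_{k+2}$ (to $t$ if $k=m-1$). *Procedure B* (marked pebble on $s$, target $t\neq s$). Let $q=c-|\mathcal A(H)\cap T(F(s),t)|$, let $z_1,\dots,z_N$ be the neighbours of $s$ not in $T(F(s),t)$ and $T_j=T(F(s),z_j)$. For $j=1,2,\dots$ let $q_j$ be the number of holes in $T_j$. If $q_j<q$, gather holes within $T_j$ in a subset $H_j$ of $T_j$ of cardinality $q_j$ closest to $s$, replace $q$ by $q-q_j$ and pass to $j+1$; otherwise gather holes within $T_j$ in a subset $H_j$ of $T_j$ of cardinality $q$ closest to $s$, and stop. Then choose $v$ in this last set $H_j$ at maximum distance from $s$, move the marked pebble to $v$, and apply Procedure A with $r=v$. *CATERPILLAR algorithm* (marked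 pebble $\bar p$ on $r$, target $t$). Return the empty plan if $r=t$; otherwise apply Procedure A if $T(F(r),t)$ contains at least $c$ holes (Case A), and Procedure B if it contains fewer than $c$ holes (Case B). **Proposition.** There is an absolute constant $C$ such that for every finite tree $T$ with $n$ vertices, every valid configuration $\mathcal A$ with $|H|\ge c$, every pebble $\bar p$ and every target $t\in V$, the following hold. 1. In Case B, Procedure B can be carried out, and every plan it can return is feasible, moves $\bar p$ to $t$, and has at most $C\,n\,c$ moves (including those of the final application of Procedure A). 2. The CATERPILLAR algorithm can be carried out, and every plan it can return is feasible, moves $\bar p$ to $t$, and has at most $C\,n\,c$ moves. -/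

import Mathlib

namespace PebbleMotion

section Tree

variable {V : Type*}

/-- The vertex set `π_{ab}` of the path of the tree `T` from `a` to `b`. -/
def pathSet (T : SimpleGraph V) (a b : V) : Set V :=
  {x | ∃ w : T.Walk a b, w.IsPath ∧ x ∈ w.support}

/-- `T(F(u), v)`: the vertices of the connected component containing `v` of the forest obtained
from `T` by deleting `u` (used for `v ≠ u`). -/
def branch (T : SimpleGraph V) (u v : V) : Set V :=
  {x | ∃ w : T.Walk x v, u ∉ w.support}

/-- The degree of a vertex. -/
noncomputable def deg (T : SimpleGraph V) (v : V) : ℕ := (T.neighborSet v).ncard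

/-- A junction is a vertex of degree greater than two. -/
def IsJunction (T : SimpleGraph V) (v : V) : Prop := 2 < deg T v

/-- `π_{ab}` is a corridor: its end nodes have degree different from two and all its internal
nodes have degree two. -/
def IsCorridor (T : SimpleGraph V) (a b : V) : Prop :=
  deg T a ≠ 2 ∧ deg T b ≠ 2 ∧ ∀ x ∈ pathSet T a b, x ≠ a → x ≠ b → deg T x = 2

/-- `c₁(T)`: the maximum length of the corridors. -/
noncomputable def c1 (T : SimpleGraph V) : ℕ :=
  sSup {d | ∃ a b, IsCorridor T a b ∧ d = T.dist a b}

/-- `c₂(T)`: the maximum length of the corridors whose two end nodes are junctions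
(`0` if there are none). -/
noncomputable def c2 (T : SimpleGraph V) : ℕ :=
  sSup {d | ∃ a b, IsCorridor T a b ∧ IsJunction T a ∧ IsJunction T b ∧ d = T.dist a b}

/-- A path graph: two nodes of degree one, all the other nodes of degree two. -/
def IsPathGraph (T : SimpleGraph V) : Prop :=
  {v | deg T v = 1}.ncard = 2 ∧ ∀ v, deg T v = 1 ∨ deg T v = 2

open Classical in
/-- The constant `c(T)`. -/
noncomputable def corridorBound (T : SimpleGraph V) : ℕ :=
  if IsPathGraph T then c1 T else max (c1 T + 1) (c2 T + 2)

/-- `d(s, W)`: the distance of a vertex from a set of vertices. -/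
noncomputable def distToSet (T : SimpleGraph V) (s : V) (W : Set V) : ℕ :=
  sInf ((fun a => T.dist s a) '' W)

/-- `W` is a subset of `X` of cardinality `q` closest to `B`, i.e. it minimizes
`d(W, B) = ∑ a ∈ W, d(a, B)` among the subsets of `X` of cardinality `q`. -/
def IsClosestSubset (T : SimpleGraph V) (X : Set V) (q : ℕ) (B : Set V) (W : Finset V) : Prop :=
  (↑W ⊆ X ∧ W.card = q) ∧
    ∀ W' : Finset V, ↑W' ⊆ X → W'.card = q →
      ∑ a ∈ W, distToSet T a B ≤ ∑ a ∈ W', distToSet T a B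

end Tree

section Configurations

variable {V P H : Type*}

/-- A valid configuration of the pebbles `P` and the holes `H`: every vertex is occupied by
exactly one pebble or hole. -/
abbrev Config (V P H : Type*) := (P ⊕ H) ≃ V

/-- The vertices occupied by pebbles. -/
def pebbleSet (A : Config V P H) : Set V := Set.range fun p : P => A (Sum.inl p)

/-- The vertices occupied by holes. -/
def holeSet (A : Config V P H) : Set V := Set.range fun h : H => A (Sum.inr h)

/-- A plan: a finite sequence of moves `u → v` along edges of the tree. -/
abbrev Plan (T : SimpleGraph V) := List T.Dart

/-- `A[u,v]`: exchange the occupants of `u` and `v`. -/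
def exchange [DecidableEq V] (A : Config V P H) (u v : V) : Config V P H :=
  A.trans (Equiv.swap u v)

/-- The partial transition function `ρ`: a move `u → v` is defined iff `v` is occupied by a hole,
and a plan is defined iff all its successive moves are. -/
def rho [DecidableEq V] {T : SimpleGraph V} : Config V P H → Plan T → Option (Config V P H)
  | A, [] => some A
  | A, e :: f => if (A.symm e.snd).isRight then rho (exchange A e.fst e.snd) f else none

/-- The configuration obtained by performing the exchanges of a plan one after the other. It
agrees with `rho` where `rho` is defined. The procedures below update configurations with it, so
that the feasibility of the plans they return is nowhere presupposed. -/
def update [DecidableEq V] {T : SimpleGraph V} (A : Config V P H) (f : Plan T) : Config V P H :=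
  f.foldl (fun B e => exchange B e.fst e.snd) A

/-- The plan `f` is feasible from `A` and moves the pebble `p` to `t`. -/
def Solves [DecidableEq V] {T : SimpleGraph V} (A : Config V P H) (p : P) (t : V) (f : Plan T) :
    Prop :=
  ∃ A', rho A f = some A' ∧ A' (Sum.inl p) = t

/-- *Bring hole from `w` to `v`*, along the path `v, u₂, …, u_{n-1}, w`: the plan
`(u_{n-1} → w, …, v → u₂)`. -/
def bringHole {T : SimpleGraph V} {v w : V} (π : T.Walk v w) : Plan T := π.darts.reverse

/-- *Move pebble from `v` to `w`*, along the path `v, u₂, …, u_{n-1}, w`: the plan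
`(v → u₂, …, u_{n-1} → w)`. -/
def movePebble {T : SimpleGraph V} {v w : V} (π : T.Walk v w) : Plan T := π.darts

end Configurations

section Gather

variable {V P H : Type*} [DecidableEq V]

/-- The loop of the gather holes procedure for the subtree with vertex set `B`.
`GatherLoop T B A Hb VP f A'`: from the configuration `A`, with the set `Hb` of holes still to be
brought to `B` and the set `VP` of vertices of `B` still to be cleared, the loop may return the
plan `f` and end in `A'`. If the path from `u` to `v` meets `B` only in `u`, then `w = u` and the
plan moving the pebble from `u` to `w` is empty. -/
inductive GatherLoop (T : SimpleGraph V) (B : Set V) :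
    Config V P H → Set H → Set V → Plan T → Config V P H → Prop
  | done (A : Config V P H) (Hb : Set H) : GatherLoop T B A Hb ∅ [] A
  | step (A : Config V P H) (Hb : Set H) (VP : Set V) (h : H) (u v w : V)
      (β : T.Walk u w) (α : T.Walk w v) (f : Plan T) (A' : Config V P H)
      (hh : h ∈ Hb) (hv : v = A (Sum.inr h))
      (hu : u ∈ VP) (hu_min : ∀ x ∈ VP, T.dist u v ≤ T.dist x v)
      (hw : w ∈ pathSet T u v ∩ B) (hw_min : ∀ x ∈ pathSet T u v ∩ B, T.dist w v ≤ T.dist x v)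
      (hβ : β.IsPath) (hα : α.IsPath)
      (rest : GatherLoop T B (update A (movePebble β ++ bringHole α)) (Hb \ {h}) (VP \ {u}) f A') :
      GatherLoop T B A Hb VP (movePebble β ++ bringHole α ++ f) A'

/-- `Gather T X B A f A'`: applied from `A` in the subtree of `T` with vertex set `X`, the
procedure that gathers holes in the subtree with vertex set `B ⊆ X` may return the plan `f` and
end in `A'`. The holes it uses are those on a set `M` of `|B|` hole positions of `X` closest
to `B`. (Paths and distances in a subtree are those of `T`.) -/
def Gather (T : SimpleGraph V) (X B : Set V) (A : Config V P H) (f : Plan T)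
    (A' : Config V P H) : Prop :=
  ∃ M : Finset V, IsClosestSubset T (holeSet A ∩ X) B.ncard B M ∧
    GatherLoop T B A {h | A (Sum.inr h) ∈ M ∧ A (Sum.inr h) ∉ B} (pebbleSet A ∩ B) f A'

end Gather

section ProcedureA

variable {V P H : Type*}

/-- The nodes `(i_k, j_k, ℓ_k)`, `k = 0, …, m`, selected along the path from `r` to `t` for the
corridor constant `c` (values of `i`, `j`, `ℓ` at indices above `m` are irrelevant). -/
structure IsCaterpillar (T : SimpleGraph V) (c : ℕ) (r t : V) (m : ℕ) (i j ℓ : ℕ → V) : Prop where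
  l_zero : ℓ 0 = r
  i_zero : T.Adj r (i 0) ∧ i 0 ∈ pathSet T r t
  /-- while `d(i_k, t) > c - 1`, the node `j_k` lies at distance `c - 2` from `i_k` towards `t` -/
  j_lt : ∀ k < m, c < T.dist (i k) t + 1 ∧ j k ∈ pathSet T (i k) t ∧ T.dist (i k) (j k) + 2 = c
  /-- the construction stops as soon as `d(i_m, t) ≤ c - 1` -/
  j_last : T.dist (i m) t + 1 ≤ c ∧ j m = t
  /-- `i_{k+1}` is the junction closest to `j_k` on the path from `j_{k-1}` to `j_k`, deprived of
  `j_{k-1}`, where `j_{-1} = i_0` -/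
  i_succ : ∀ k < m, let a := if k = 0 then i 0 else j (k - 1)
    let S := {x | x ∈ pathSet T a (j k) ∧ x ≠ a ∧ IsJunction T x}
    i (k + 1) ∈ S ∧ ∀ x ∈ S, T.dist (i (k + 1)) (j k) ≤ T.dist x (j k)
  l_succ : ∀ k < m, T.Adj (i (k + 1)) (ℓ (k + 1)) ∧ ℓ (k + 1) ∉ pathSet T r t

/-- The caterpillar sets `S_0, …, S_m`. -/
def catSet (T : SimpleGraph V) (m : ℕ) (i j ℓ : ℕ → V) (k : ℕ) : Set V :=
  if k < m then pathSet T (i k) (j k) ∪ {ℓ k} ∪ {ℓ (k + 1)} else pathSet T (i k) (j k) ∪ {ℓ k}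

/-- Where the marked pebble goes from the parking position `ℓ_k`: to `ℓ_{k+1}` if `k < m`, and to
the target if `k = m`. -/
def nextStop (t : V) (m : ℕ) (ℓ : ℕ → V) (k : ℕ) : V := if k < m then ℓ (k + 1) else t

variable [DecidableEq V]

/-- The iterations `k, …, m - 1` of the `for` cycle of Procedure A. Iteration `k` first gathers
holes in `S_{k+1} \ {ℓ_{k+1}}`, within the subtree on `(S_k ∪ S_{k+1}) \ {ℓ_{k+1}}` (the marked
pebble stands on `ℓ_{k+1}`), and then moves the marked pebble to `ℓ_{k+2}` or `t`. -/
inductive SlideLoop (T : SimpleGraph V) (t : V) (m : ℕ) (i j ℓ : ℕ → V) :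
    ℕ → Config V P H → Plan T → Prop
  | done (A : Config V P H) : SlideLoop T t m i j ℓ m A []
  | step (k : ℕ) (A A' : Config V P H) (g f : Plan T)
      (β : T.Walk (ℓ (k + 1)) (nextStop t m ℓ (k + 1))) (hk : k < m)
      (gather : Gather T
        ((catSet T m i j ℓ k ∪ catSet T m i j ℓ (k + 1)) \ {ℓ (k + 1)})
        (catSet T m i j ℓ (k + 1) \ {ℓ (k + 1)}) A g A')
      (hβ : β.IsPath)
      (rest : SlideLoop T t m i j ℓ (k + 1) (update A' (movePebble β)) f) :
      SlideLoop T t m i j ℓ k A (g ++ movePebble β ++ f)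

/-- Procedure A, with corridor constant `c`, for the marked pebble on `r` and the target `t`, may
return the plan `f` from the configuration `A`: gather holes in `S_0 \ {ℓ_0}` inside `T(F(r), t)`,
move the marked pebble from `ℓ_0 = r` to `ℓ_1` (to `t` if `m = 0`), run the `for` cycle. -/
def ProcA (T : SimpleGraph V) (c : ℕ) (r t : V) (A : Config V P H) (f : Plan T) : Prop :=
  ∃ (m : ℕ) (i j ℓ : ℕ → V) (g f' : Plan T) (A' : Config V P H)
    (β : T.Walk (ℓ 0) (nextStop t m ℓ 0)),
    IsCaterpillar T c r t m i j ℓ ∧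
    Gather T (branch T r t) (catSet T m i j ℓ 0 \ {ℓ 0}) A g A' ∧
    β.IsPath ∧
    SlideLoop T t m i j ℓ 0 (update A' (movePebble β)) f' ∧
    f = g ++ movePebble β ++ f'

end ProcedureA

section ProcedureB

variable {V P H : Type*} [DecidableEq V]

/-- The gathering phase of Procedure B. `BranchLoop T s zs q A f A' K`: with the branches at `s`
through the nodes of the list `zs` still to be treated and `q` holes still missing, it may return
the plan `f`, end in the configuration `A'`, and have `K` as the last of the sets `H_j`. In the
branch `T_j = T(F(s), z_j)`, with `q_j` holes, it gathers `min(q_j, q)` holes in a subset `H_j` of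
`T_j` of that cardinality closest to `s`, and it stops when no hole is missing any more. -/
inductive BranchLoop (T : SimpleGraph V) (s : V) :
    List V → ℕ → Config V P H → Plan T → Config V P H → Finset V → Prop
  | more (z : V) (zs : List V) (q qj : ℕ) (A A₁ A₂ : Config V P H) (g f : Plan T)
      (Hj K : Finset V)
      (hqj : qj = (holeSet A ∩ branch T s z).ncard) (hlt : qj < q)
      (hHj : IsClosestSubset T (branch T s z) qj {s} Hj)
      (gather : Gather T (branch T s z) ↑Hj A g A₁)
      (rest : BranchLoop T s zs (q - qj) A₁ f A₂ K) :
      BranchLoop T s (z :: zs) q A (g ++ f) A₂ K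
  | last (z : V) (zs : List V) (q : ℕ) (A A₁ : Config V P H) (g : Plan T) (Hj : Finset V)
      (hle : q ≤ (holeSet A ∩ branch T s z).ncard)
      (hHj : IsClosestSubset T (branch T s z) q {s} Hj)
      (gather : Gather T (branch T s z) ↑Hj A g A₁) :
      BranchLoop T s (z :: zs) q A g A₁ Hj

/-- Procedure B, with corridor constant `c`, for the marked pebble on `s` and the target `t`, may
return the plan `f` from the configuration `A`: list the neighbours of `s` outside `T(F(s), t)`,
gather in their branches the `q` holes that `T(F(s), t)` lacks, move the marked pebble to a node
`v` of the last set `H_j` at maximum distance from `s`, and apply Procedure A from `v`. -/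
def ProcB (T : SimpleGraph V) (c : ℕ) (s t : V) (A : Config V P H) (f : Plan T) : Prop :=
  ∃ (zs : List V) (g f' : Plan T) (A' : Config V P H) (K : Finset V) (v : V) (β : T.Walk s v),
    zs.Nodup ∧ (∀ z, z ∈ zs ↔ T.Adj s z ∧ z ∉ branch T s t) ∧
    BranchLoop T s zs (c - (holeSet A ∩ branch T s t).ncard) A g A' K ∧
    v ∈ K ∧ (∀ x ∈ K, T.dist s x ≤ T.dist s v) ∧
    β.IsPath ∧
    ProcA T c v t (update A' (movePebble β)) f' ∧
    f = g ++ movePebble β ++ f'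

/-- Case A: the marked pebble, on `r ≠ t`, has at least `c(T)` holes in `T(F(r), t)`. -/
def CaseA (T : SimpleGraph V) (r t : V) (A : Config V P H) : Prop :=
  r ≠ t ∧ corridorBound T ≤ (holeSet A ∩ branch T r t).ncard

/-- Case B: the marked pebble, on `r ≠ t`, has fewer than `c(T)` holes in `T(F(r), t)`. -/
def CaseB (T : SimpleGraph V) (r t : V) (A : Config V P H) : Prop :=
  r ≠ t ∧ (holeSet A ∩ branch T r t).ncard < corridorBound T

/-- The CATERPILLAR algorithm for the marked pebble `p` and the target `t` may return the plan `f`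
from `A`: the empty plan if `p` is already on `t`, else Procedure A in Case A and Procedure B in
Case B. -/
def Caterpillar (T : SimpleGraph V) (p : P) (t : V) (A : Config V P H) (f : Plan T) : Prop :=
  (A (Sum.inl p) = t ∧ f = []) ∨
  (CaseA T (A (Sum.inl p)) t A ∧ ProcA T (corridorBound T) (A (Sum.inl p)) t A f) ∨
  (CaseB T (A (Sum.inl p)) t A ∧ ProcB T (corridorBound T) (A (Sum.inl p)) t A f)

end ProcedureB

end PebbleMotion

/-! Membership in a tree path is additivity of distances, so positions along the path from `r` to
`t` can be measured by `T.dist r ·`, and a subtree is a set closed under paths (`PathClosed`).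

Gathering works because each round has one net effect on the subtree `B`: one chosen pebble vertex
becomes a hole (`gather_iteration`). A gathering within `X` thus costs at most |B||X| moves, and it
can be completed as soon as `X` holds |B| holes (`Gather.spec`, `exists_gather`).

In Procedure A, each set S_k without the parking node of the marked pebble has at most c vertices.
After the pebble has moved on to ℓ_{k+1}, the other c vertices of S_k are all holes, just enough for
the next gathering. So the c initial holes serve every phase. A phase costs O(c²) and there are
O(n/c) phases, since d(r, i_k) + d(r, j_{k-1}) grows by at least c - 1 per phase
(`IsCaterpillar.mul_le`). The first gathering costs O(nc). The next parking junction always exists,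
because otherwise the path would contain a corridor longer than the definition of c permits
(`exists_junction`).

In Procedure B, gathering and parking cost O(nc). The parking node v is a farthest vertex of the
last cleared set K, so no other vertex of K lies behind it. Hence all the holes counted in T(F(s),
t), in K and in the other branches at s end up on the target side of v. There are at least c of
them, and Procedure A applies (`exists_procB`). -/

namespace PebbleMotion

/-! ### Paths, subtrees and branches of a tree, expressed by distances. -/

section TreeFacts

variable {V : Type*} {T : SimpleGraph V}

theorem mem_pathSet_iff_mem_support (hT : T.IsTree) {a b x : V} {w : T.Walk a b} (hw : w.IsPath) :
    x ∈ pathSet T a b ↔ x ∈ w.support := by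
  constructor
  · rintro ⟨w', hw', hx⟩
    rwa [(hT.existsUnique_path a b).unique hw hw']
  · exact fun hx => ⟨w, hw, hx⟩

theorem length_eq_dist (hT : T.IsTree) {a b : V} {w : T.Walk a b} (hw : w.IsPath) :
    w.length = T.dist a b := by
  obtain ⟨p, hp, hl⟩ := hT.connected.exists_path_of_dist a b
  rw [(hT.existsUnique_path a b).unique hw hp, hl]

theorem exists_isPath (hT : T.IsTree) (a b : V) : ∃ w : T.Walk a b, w.IsPath :=
  let ⟨p, hp, _⟩ := hT.connected.exists_path_of_dist a b
  ⟨p, hp⟩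

theorem pathSet_subset_support (hT : T.IsTree) {a b x : V} (w : T.Walk a b)
    (hx : x ∈ pathSet T a b) : x ∈ w.support := by
  classical
  exact w.support_bypass_subset_support
    ((mem_pathSet_iff_mem_support hT (w := w.bypass) w.bypass_isPath).1 hx)

/-- Reduces questions about paths to linear arithmetic on distances. Conversely to cutting a path at
x, two geodesics glued at x have the length of a geodesic and so form a path. -/
theorem mem_pathSet_iff (hT : T.IsTree) {a b x : V} :
    x ∈ pathSet T a b ↔ T.dist a x + T.dist x b = T.dist a b := by
  classical
  constructor
  · rintro ⟨w, hw, hx⟩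
    have h1 := length_eq_dist hT (hw.takeUntil hx)
    have h2 := length_eq_dist hT (hw.dropUntil hx)
    have h3 := length_eq_dist hT hw
    have h4 := congrArg SimpleGraph.Walk.length (w.take_spec hx)
    rw [SimpleGraph.Walk.length_append] at h4
    omega
  · intro h
    obtain ⟨p, -, hp⟩ := hT.connected.exists_path_of_dist a x
    obtain ⟨q, -, hq⟩ := hT.connected.exists_path_of_dist x b
    refine ⟨p.append q, SimpleGraph.Walk.isPath_of_length_eq_dist _ ?_, ?_⟩
    · rw [SimpleGraph.Walk.length_append]; omega
    · rw [SimpleGraph.Walk.mem_support_append_iff]; exact Or.inl p.end_mem_support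

theorem left_mem_pathSet (hT : T.IsTree) (a b : V) : a ∈ pathSet T a b := by
  simp [mem_pathSet_iff hT]

theorem right_mem_pathSet (hT : T.IsTree) (a b : V) : b ∈ pathSet T a b := by
  simp [mem_pathSet_iff hT]

theorem eq_of_dist_eq_zero (hT : T.IsTree) {a b : V} (h : T.dist a b = 0) : a = b :=
  hT.connected.dist_eq_zero_iff.1 h

theorem pathSet_comm (hT : T.IsTree) (a b : V) : pathSet T a b = pathSet T b a := by
  ext x
  rw [mem_pathSet_iff hT, mem_pathSet_iff hT, T.dist_comm (u := a) (v := x),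
    T.dist_comm (u := x) (v := b), T.dist_comm (u := a) (v := b), add_comm]

theorem mem_pathSet_self (hT : T.IsTree) {a x : V} : x ∈ pathSet T a a ↔ x = a := by
  rw [mem_pathSet_iff hT, T.dist_comm (u := a) (v := x), SimpleGraph.dist_self]
  constructor
  · intro h; exact eq_of_dist_eq_zero hT (by omega)
  · rintro rfl; simp

theorem pathSet_subset_union (hT : T.IsTree) (a b y : V) :
    pathSet T a b ⊆ pathSet T a y ∪ pathSet T y b := by
  intro x hx
  obtain ⟨p, hp⟩ := exists_isPath hT a y
  obtain ⟨q, hq⟩ := exists_isPath hT y b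
  have := pathSet_subset_support hT (p.append q) hx
  rw [SimpleGraph.Walk.mem_support_append_iff] at this
  exact this.imp (fun h => ⟨p, hp, h⟩) (fun h => ⟨q, hq, h⟩)

theorem pathSet_adj (hT : T.IsTree) {a b x : V} (h : T.Adj a b) :
    x ∈ pathSet T a b ↔ x = a ∨ x = b := by
  constructor
  · intro hx
    have := pathSet_subset_support hT h.toWalk hx
    simpa using this
  · rintro (rfl | rfl)
    · exact left_mem_pathSet hT _ _
    · exact right_mem_pathSet hT _ _

theorem dist_of_mem_pathSet (hT : T.IsTree) {r t x y : V} (hx : x ∈ pathSet T r t)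
    (hy : y ∈ pathSet T r t) (hxy : T.dist r x ≤ T.dist r y) :
    T.dist r x + T.dist x y = T.dist r y := by
  rcases pathSet_subset_union hT r t y hx with h | h
  · exact (mem_pathSet_iff hT).1 h
  · rw [mem_pathSet_iff hT] at h hx hy
    have := T.dist_comm (u := x) (v := y)
    omega

theorem eq_of_mem_pathSet (hT : T.IsTree) {r t x y : V} (hx : x ∈ pathSet T r t)
    (hy : y ∈ pathSet T r t) (hxy : T.dist r x = T.dist r y) : x = y := by
  have := dist_of_mem_pathSet hT hx hy hxy.le
  exact eq_of_dist_eq_zero hT (by omega)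

theorem exists_mem_pathSet_dist_eq (hT : T.IsTree) {r t : V} {k : ℕ} (hk : k ≤ T.dist r t) :
    ∃ x ∈ pathSet T r t, T.dist r x = k := by
  obtain ⟨p, hp, hl⟩ := hT.connected.exists_path_of_dist r t
  refine ⟨p.getVert k, ⟨p, hp, p.getVert_mem_support k⟩, ?_⟩
  rw [← length_eq_dist hT (hp.take k), SimpleGraph.Walk.take_length]
  omega

theorem ncard_pathSet (hT : T.IsTree) (a b : V) : (pathSet T a b).ncard = T.dist a b + 1 := by
  classical
  obtain ⟨p, hp⟩ := exists_isPath hT a b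
  have : pathSet T a b = (p.support.toFinset : Set V) := by
    ext x; simp [mem_pathSet_iff_mem_support hT hp]
  rw [this, Set.ncard_coe_finset, List.toFinset_card_of_nodup hp.support_nodup,
    SimpleGraph.Walk.length_support, length_eq_dist hT hp]

theorem dist_adj_cases (hT : T.IsTree) (u : V) {x y : V} (h : T.Adj x y) :
    T.dist u x = T.dist u y + 1 ∨ T.dist u y = T.dist u x + 1 :=
  (hT.dist_eq_dist_add_one_of_adj u h)

/-- A vertex set containing, with any two vertices, the path between them. -/
def PathClosed (T : SimpleGraph V) (B : Set V) : Prop :=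
  ∀ a ∈ B, ∀ b ∈ B, pathSet T a b ⊆ B

theorem pathClosed_pathSet (hT : T.IsTree) (a b : V) : PathClosed T (pathSet T a b) := by
  classical
  rintro x ⟨w, hw, hx⟩ y hy z hz
  rw [mem_pathSet_iff_mem_support hT hw] at hy
  have := pathSet_subset_support hT ((w.takeUntil x hx).reverse.append (w.takeUntil y hy)) hz
  rw [SimpleGraph.Walk.mem_support_append_iff, SimpleGraph.Walk.support_reverse,
    List.mem_reverse] at this
  exact ⟨w, hw, this.elim (fun h => w.support_takeUntil_subset_support hx h)
    (fun h => w.support_takeUntil_subset_support hy h)⟩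

theorem pathClosed_of_base (hT : T.IsTree) {B : Set V} (y : V)
    (h : ∀ x ∈ B, pathSet T y x ⊆ B) : PathClosed T B := by
  intro a ha b hb x hx
  rcases pathSet_subset_union hT a b y hx with hx | hx
  · rw [pathSet_comm hT] at hx; exact h a ha hx
  · exact h b hb hx

theorem PathClosed.union (hT : T.IsTree) {B C : Set V} (hB : PathClosed T B) (hC : PathClosed T C)
    {y : V} (hyB : y ∈ B) (hyC : y ∈ C) : PathClosed T (B ∪ C) :=
  pathClosed_of_base hT y fun x hx => hx.elim
    (fun hx => (hB y hyB x hx).trans Set.subset_union_left)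
    (fun hx => (hC y hyC x hx).trans Set.subset_union_right)

theorem PathClosed.union_singleton (hT : T.IsTree) {B : Set V} (hB : PathClosed T B) {y l : V}
    (hy : y ∈ B) (hl : T.Adj y l) : PathClosed T (B ∪ {l}) := by
  have h := hB.union hT (pathClosed_pathSet hT y l) hy (left_mem_pathSet hT y l)
  have : B ∪ pathSet T y l = B ∪ {l} := by
    ext x
    simp only [Set.mem_union, pathSet_adj hT hl, Set.mem_singleton_iff]
    constructor
    · rintro (h | rfl | h) <;> tauto
    · tauto
  rwa [this] at h

/-- If l were the nearer end of the edge, it would lie on the path from x to y, hence in B. -/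
theorem PathClosed.dist_of_adj (hT : T.IsTree) {B : Set V} (hB : PathClosed T B) {y l x : V}
    (hy : y ∈ B) (hl : T.Adj y l) (hlB : l ∉ B) (hx : x ∈ B) : T.dist x l = T.dist x y + 1 := by
  rcases dist_adj_cases hT x hl with h | h
  · refine absurd (hB x hx y hy ?_) hlB
    rw [mem_pathSet_iff hT, h, SimpleGraph.dist_eq_one_iff_adj.2 hl.symm]
  · exact h

theorem PathClosed.dist_lt_ncard [Finite V] (hT : T.IsTree) {B : Set V} (hB : PathClosed T B)
    {x y : V} (hx : x ∈ B) (hy : y ∈ B) : T.dist x y < B.ncard := by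
  have := Set.ncard_le_ncard (hB x hx y hy) (Set.toFinite B)
  rw [ncard_pathSet hT] at this
  omega

theorem dist_lt_card [Fintype V] (hT : T.IsTree) (x y : V) : T.dist x y < Fintype.card V := by
  have h := Set.ncard_le_ncard (Set.subset_univ (pathSet T x y)) (Set.toFinite _)
  rw [ncard_pathSet hT, Set.ncard_univ, Nat.card_eq_fintype_card] at h
  omega

theorem mem_branch_iff (hT : T.IsTree) {u v x : V} :
    x ∈ branch T u v ↔ u ∉ pathSet T x v := by
  constructor
  · rintro ⟨w, hw⟩ h
    exact hw (pathSet_subset_support hT w h)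
  · intro h
    obtain ⟨w, hw⟩ := exists_isPath hT x v
    exact ⟨w, fun h' => h ⟨w, hw, h'⟩⟩

theorem notMem_branch_self (u v : V) : u ∉ branch T u v := by
  rintro ⟨w, hw⟩
  exact hw w.start_mem_support

theorem self_mem_branch {u v : V} (h : v ≠ u) : v ∈ branch T u v :=
  ⟨SimpleGraph.Walk.nil, by simpa using h.symm⟩

theorem branch_eq_of_mem {u v x : V} (h : x ∈ branch T u v) : branch T u x = branch T u v := by
  obtain ⟨w, hw⟩ := h
  ext y
  constructor
  · rintro ⟨w', hw'⟩
    exact ⟨w'.append w, by simp [SimpleGraph.Walk.mem_support_append_iff, hw, hw']⟩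
  · rintro ⟨w', hw'⟩
    exact ⟨w'.append w.reverse, by simp [SimpleGraph.Walk.mem_support_append_iff, hw, hw']⟩

theorem pathClosed_branch (hT : T.IsTree) (u v : V) : PathClosed T (branch T u v) := by
  refine pathClosed_of_base hT v fun x hx y hy => ?_
  rw [mem_branch_iff hT] at hx ⊢
  intro h
  rw [pathSet_comm hT] at hy
  exact hx (pathClosed_pathSet hT x v y hy v (right_mem_pathSet hT x v) h)

theorem subset_branch {u v : V} {Y : Set V} (hT : T.IsTree) (hY : PathClosed T Y) (hv : v ∈ Y)
    (hu : u ∉ Y) : Y ⊆ branch T u v :=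
  fun x hx => (mem_branch_iff hT).2 fun h => hu (hY x hx v hv h)

end TreeFacts

/-! ### Feasibility, locality and effect of the elementary plans. -/

section Dynamics

set_option linter.unusedSectionVars false

variable {V P H : Type*} [DecidableEq V] {T : SimpleGraph V}

@[simp] theorem update_nil (A : Config V P H) : update A ([] : Plan T) = A := rfl

@[simp] theorem update_cons (A : Config V P H) (e : T.Dart) (f : Plan T) :
    update A (e :: f) = update (exchange A e.fst e.snd) f := rfl

theorem update_append (A : Config V P H) (f g : Plan T) :
    update A (f ++ g) = update (update A f) g := by
  simp [update, List.foldl_append]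

/-- The plan `f` is feasible from `A`. -/
def Feasible (A : Config V P H) (f : Plan T) : Prop := rho A f = some (update A f)

theorem feasible_nil (A : Config V P H) : Feasible A ([] : Plan T) := rfl

theorem feasible_cons {A : Config V P H} {e : T.Dart} {f : Plan T}
    (he : e.snd ∈ holeSet A) (hf : Feasible (exchange A e.fst e.snd) f) :
    Feasible A (e :: f) := by
  obtain ⟨h, hh⟩ := he
  have : A.symm e.snd = Sum.inr h := by rw [← hh]; simp
  simp [Feasible, rho, this]
  exact hf

theorem Feasible.append {A : Config V P H} {f g : Plan T} (hf : Feasible A f)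
    (hg : Feasible (update A f) g) : Feasible A (f ++ g) := by
  induction f generalizing A with
  | nil => exact hg
  | cons e f ih =>
    have hf' : rho A (e :: f) = some (update A (e :: f)) := hf
    rw [rho] at hf'
    split at hf'
    · rename_i h
      change rho A (e :: (f ++ g)) = some (update (exchange A e.fst e.snd) (f ++ g))
      rw [rho, if_pos h]
      exact ih hf' hg
    · simp at hf'

theorem exchange_apply (A : Config V P H) (u v : V) (x : P ⊕ H) :
    exchange A u v x = Equiv.swap u v (A x) := rfl

/-- All the moves of the plan take place inside `S`. -/
def Within (S : Set V) (f : Plan T) : Prop := ∀ e ∈ f, e.fst ∈ S ∧ e.snd ∈ S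

theorem within_nil (S : Set V) : Within S ([] : Plan T) := by simp [Within]

theorem Within.append {S : Set V} {f g : Plan T} (hf : Within S f) (hg : Within S g) :
    Within S (f ++ g) := by
  intro e he
  rcases List.mem_append.1 he with h | h
  exacts [hf e h, hg e h]

theorem Within.mono {S S' : Set V} (h : S ⊆ S') {f : Plan T} (hf : Within S f) : Within S' f :=
  fun e he => ⟨h (hf e he).1, h (hf e he).2⟩

theorem Within.update_apply_of_notMem {S : Set V} {f : Plan T} (hf : Within S f)
    {A : Config V P H} {x : P ⊕ H} (hx : A x ∉ S) : update A f x = A x := by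
  induction f generalizing A with
  | nil => rfl
  | cons e f ih =>
    have he := hf e (by simp)
    have h1 : exchange A e.fst e.snd x = A x := by
      rw [exchange_apply]
      exact Equiv.swap_apply_of_ne_of_ne (fun h => hx (h ▸ he.1)) (fun h => hx (h ▸ he.2))
    rw [update_cons, ih (fun e' he' => hf e' (by simp [he'])) (by rwa [h1]), h1]

theorem Within.update_apply_mem {S : Set V} {f : Plan T} (hf : Within S f)
    {A : Config V P H} {x : P ⊕ H} (hx : A x ∈ S) : update A f x ∈ S := by
  induction f generalizing A with
  | nil => exact hx
  | cons e f ih =>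
    have he := hf e (by simp)
    refine ih (fun e' he' => hf e' (by simp [he'])) ?_
    rw [exchange_apply, Equiv.swap_apply_def]
    split_ifs
    exacts [he.2, he.1, hx]

theorem Within.update_apply_mem_iff {S : Set V} {f : Plan T} (hf : Within S f)
    {A : Config V P H} {x : P ⊕ H} : update A f x ∈ S ↔ A x ∈ S := by
  refine ⟨fun h => ?_, hf.update_apply_mem⟩
  by_contra hx
  rw [hf.update_apply_of_notMem hx] at h
  exact hx h

/-- A plan inside `S` preserves every set that contains `S` or is disjoint from it. -/
theorem Within.update_apply_mem_iff_of_disjoint {S Y : Set V} {f : Plan T} (hf : Within S f)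
    (hY : Disjoint S Y) {A : Config V P H} {x : P ⊕ H} : update A f x ∈ Y ↔ A x ∈ Y := by
  by_cases hx : A x ∈ S
  · exact iff_of_false (fun h => hY.ne_of_mem (hf.update_apply_mem hx) h rfl)
      (fun h => hY.ne_of_mem hx h rfl)
  · rw [hf.update_apply_of_notMem hx]

/-- Counting labels instead of positions makes hole counts comparable between configurations: it is
enough that no occupant crosses the boundary of Y. -/
theorem ncard_holeSet_inter (A : Config V P H) (Y : Set V) :
    (holeSet A ∩ Y).ncard = {h : H | A (Sum.inr h) ∈ Y}.ncard := by
  have : holeSet A ∩ Y = (fun h => A (Sum.inr h)) '' {h : H | A (Sum.inr h) ∈ Y} := by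
    ext y
    constructor
    · rintro ⟨⟨h, rfl⟩, hy⟩; exact ⟨h, hy, rfl⟩
    · rintro ⟨h, hy, rfl⟩; exact ⟨⟨h, rfl⟩, hy⟩
  rw [this]
  exact Set.ncard_image_of_injective _ (A.injective.comp Sum.inr_injective)

theorem ncard_holeSet_inter_congr {A A' : Config V P H} {Y : Set V}
    (h : ∀ x, A' x ∈ Y ↔ A x ∈ Y) : (holeSet A' ∩ Y).ncard = (holeSet A ∩ Y).ncard := by
  rw [ncard_holeSet_inter, ncard_holeSet_inter]
  simp only [h]

theorem mem_holeSet_or_mem_pebbleSet (A : Config V P H) (y : V) :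
    y ∈ holeSet A ∨ y ∈ pebbleSet A := by
  rcases h : A.symm y with p | k
  · exact Or.inr ⟨p, by simp [← h]⟩
  · exact Or.inl ⟨k, by simp [← h]⟩

theorem notMem_holeSet_of_mem_pebbleSet {A : Config V P H} {y : V} (h : y ∈ pebbleSet A) :
    y ∉ holeSet A := by
  rintro ⟨k, hk⟩
  obtain ⟨p, hp⟩ := h
  have := A.injective (hk.trans hp.symm)
  simp at this

theorem mem_holeSet_iff {A : Config V P H} {y : V} : y ∈ holeSet A ↔ y ∉ pebbleSet A :=
  ⟨fun h h' => notMem_holeSet_of_mem_pebbleSet h' h,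
    fun h => (mem_holeSet_or_mem_pebbleSet A y).resolve_right h⟩

theorem within_movePebble {u w : V} (β : T.Walk u w) :
    Within {x | x ∈ β.support} (movePebble β) :=
  fun _ he => ⟨β.dart_fst_mem_support_of_mem_darts he, β.dart_snd_mem_support_of_mem_darts he⟩

theorem within_bringHole {u w : V} (β : T.Walk u w) :
    Within {x | x ∈ β.support} (bringHole β) :=
  fun e he => within_movePebble β e (List.mem_reverse.1 he)

theorem length_movePebble {u w : V} (β : T.Walk u w) : (movePebble β).length = β.length := by
  simp [movePebble]

theorem length_bringHole {u w : V} (β : T.Walk u w) : (bringHole β).length = β.length := by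
  simp [bringHole]

/-- The occupant of the first vertex of a path is moved along the path through holes. -/
theorem movePebble_spec {u w : V} (β : T.Walk u w) (hβ : β.IsPath) (A : Config V P H)
    (hh : ∀ x ∈ β.support, x ≠ u → x ∈ holeSet A) (y : P ⊕ H) (hy : A y = u) :
    Feasible A (movePebble β) ∧ update A (movePebble β) y = w := by
  induction β generalizing A with
  | nil => exact ⟨feasible_nil A, hy⟩
  | @cons a b d hab q ih =>
    rw [SimpleGraph.Walk.cons_isPath_iff] at hβ
    have hb : b ∈ holeSet A := hh b (by simp) hab.ne'
    have key := ih hβ.1 (exchange A a b) (fun x hx hxb => by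
      obtain ⟨k, hk⟩ := hh x (by simp [hx]) (fun h => hβ.2 (h ▸ hx))
      refine ⟨k, ?_⟩
      change Equiv.swap a b (A (Sum.inr k)) = x
      simp only at hk
      rw [hk]
      exact Equiv.swap_apply_of_ne_of_ne (fun h => hβ.2 (h ▸ hx)) hxb) (by
        rw [exchange_apply, hy, Equiv.swap_apply_left])
    exact ⟨feasible_cons hb key.1, key.2⟩

/-- The plan permutes the occupants of the path. The one that started on u ends on w, so every other
vertex of the path receives one of the holes. -/
theorem holeSet_movePebble {u w : V} (β : T.Walk u w) (hβ : β.IsPath) (A : Config V P H)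
    (hh : ∀ x ∈ β.support, x ≠ u → x ∈ holeSet A) {x : V} (hx : x ∈ β.support) (hxw : x ≠ w) :
    x ∈ holeSet (update A (movePebble β)) := by
  obtain ⟨y, hy⟩ := A.surjective u
  have hw := (movePebble_spec β hβ A hh y hy).2
  obtain ⟨z, hz⟩ := (update A (movePebble β)).surjective x
  have hzs : A z ∈ β.support :=
    (within_movePebble β).update_apply_mem_iff.1 (show _ ∈ {x | x ∈ β.support} by rw [hz]; exact hx)
  have hzu : A z ≠ u := by
    intro h
    have : z = y := A.injective (h.trans hy.symm)
    exact hxw (by rw [← hz, this, hw])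
  obtain ⟨k, hk⟩ := hh _ hzs hzu
  have : Sum.inr k = z := A.injective hk
  exact ⟨k, by simp only [this, hz]⟩

/-- Nothing is asked of the other occupants of the path: each move enters the vertex where h itself
currently stands. -/
theorem bringHole_spec {w v : V} (α : T.Walk w v) (hα : α.IsPath) (A : Config V P H)
    (h : H) (hv : A (Sum.inr h) = v) :
    Feasible A (bringHole α) ∧ update A (bringHole α) (Sum.inr h) = w := by
  induction α with
  | nil => exact ⟨feasible_nil A, hv⟩
  | @cons a b d hab q ih =>
    rw [SimpleGraph.Walk.cons_isPath_iff] at hα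
    have key := ih hα.1 hv
    have e : bringHole (SimpleGraph.Walk.cons hab q) = bringHole q ++ [⟨(a, b), hab⟩] := by
      simp [bringHole]
    rw [e, update_append]
    refine ⟨key.1.append (feasible_cons ⟨h, key.2⟩ (feasible_nil _)), ?_⟩
    rw [update_cons, update_nil, exchange_apply, key.2]
    exact Equiv.swap_apply_right _ _

end Dynamics

/-! ### Correctness, cost and existence of gatherings. -/

section GatherFacts

set_option linter.unusedSectionVars false

variable {V P H : Type*} [DecidableEq V] {T : SimpleGraph V}

theorem distToSet_eq_zero {B : Set V} {x : V} (hx : x ∈ B) : distToSet T x B = 0 :=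
  Nat.eq_zero_of_le_zero (Nat.sInf_le ⟨x, hx, by simp⟩)

theorem distToSet_pos (hT : T.IsTree) {B : Set V} {x : V} (hB : B.Nonempty) (hx : x ∉ B) :
    0 < distToSet T x B := by
  obtain ⟨y, hy, h⟩ := Nat.sInf_mem (hB.image (fun a => T.dist x a))
  change 0 < sInf _
  rw [← h]
  exact hT.connected.pos_dist_of_ne (fun h => hx (h ▸ hy))

theorem distToSet_singleton (x s : V) : distToSet T x {s} = T.dist x s := by
  simp [distToSet]

theorem exists_isClosestSubset [Finite V] (T : SimpleGraph V) {X : Set V} {q : ℕ} (B : Set V)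
    (hq : q ≤ X.ncard) : ∃ W, IsClosestSubset T X q B W := by
  classical
  have hX : X.Finite := Set.toFinite X
  rw [Set.ncard_eq_toFinset_card X hX] at hq
  obtain ⟨W, hW, hmin⟩ := Finset.exists_min_image (Finset.powersetCard q hX.toFinset)
    (fun W => ∑ a ∈ W, distToSet T a B) (Finset.powersetCard_nonempty.2 hq)
  simp only [Finset.mem_powersetCard] at hW hmin
  refine ⟨W, ⟨fun x hx => hX.mem_toFinset.1 (hW.1 hx), hW.2⟩, fun W' h1 h2 => hmin W' ⟨?_, h2⟩⟩
  exact fun x hx => hX.mem_toFinset.2 (h1 hx)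

/-- Exchange property of closest subsets. -/
theorem IsClosestSubset.le {X B : Set V} {q : ℕ} {W : Finset V} (h : IsClosestSubset T X q B W)
    {x y : V} (hx : x ∈ W) (hy : y ∈ X) (hyW : y ∉ W) : distToSet T x B ≤ distToSet T y B := by
  classical
  have hyE : y ∉ W.erase x := fun h => hyW (Finset.mem_of_mem_erase h)
  have h1 := h.2 (insert y (W.erase x)) (by
    intro z hz
    rcases Finset.mem_insert.1 (Finset.mem_coe.1 hz) with rfl | hz
    exacts [hy, h.1.1 (Finset.mem_of_mem_erase hz)]) (by
    rw [Finset.card_insert_of_notMem hyE, Finset.card_erase_add_one hx, h.1.2])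
  rw [Finset.sum_insert hyE] at h1
  have h2 := Finset.add_sum_erase W (fun a => distToSet T a B) hx
  omega

/-- Minimality of u leaves no other pebble between u and w, since such a pebble would be closer to
v. Minimality of w makes the rest of the path leave B at once. So the pebble slides from u to w
through holes, and the incoming hole disturbs B only at w, where it replaces that pebble. The last
clause keeps the unused holes outside B, as the next round requires. -/
theorem gather_iteration (hT : T.IsTree) {B X : Set V} (hB : PathClosed T B) (hX : PathClosed T X)
    (hBX : B ⊆ X) {A : Config V P H} {h : H} {u v w : V} (β : T.Walk u w) (α : T.Walk w v)
    (hv : v = A (Sum.inr h)) (hvB : v ∉ B) (hvX : v ∈ X) (hu : u ∈ pebbleSet A ∩ B)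
    (hu_min : ∀ x ∈ pebbleSet A ∩ B, T.dist u v ≤ T.dist x v)
    (hw : w ∈ pathSet T u v ∩ B) (hw_min : ∀ x ∈ pathSet T u v ∩ B, T.dist w v ≤ T.dist x v)
    (hβ : β.IsPath) (hα : α.IsPath) :
    Feasible A (movePebble β ++ bringHole α) ∧ Within X (movePebble β ++ bringHole α) ∧
    (movePebble β ++ bringHole α).length = T.dist u v ∧
    pebbleSet (update A (movePebble β ++ bringHole α)) ∩ B = (pebbleSet A ∩ B) \ {u} ∧
    ∀ x, A x ∉ B → x ≠ Sum.inr h → update A (movePebble β ++ bringHole α) x ∉ B := by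
  have huw : T.dist u w + T.dist w v = T.dist u v := (mem_pathSet_iff hT).1 hw.1
  have hβB : {x | x ∈ β.support} ⊆ B := fun x hx => hB u hu.2 w hw.2 ⟨β, hβ, hx⟩
  have hαX : {x | x ∈ α.support} ⊆ X := fun x hx => hX w (hBX hw.2) v hvX ⟨α, hα, hx⟩
  have hαB : ∀ x ∈ α.support, x ∈ B → x = w := by
    intro x hx hxB
    have h1 := (mem_pathSet_iff hT).1 ((⟨α, hα, hx⟩ : x ∈ pathSet T w v))
    have h2 : x ∈ pathSet T u v := pathClosed_pathSet hT u v w hw.1 v (right_mem_pathSet hT u v)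
      ⟨α, hα, hx⟩
    have h3 := hw_min x ⟨h2, hxB⟩
    exact (eq_of_dist_eq_zero hT (by omega)).symm
  have hβh : ∀ x ∈ β.support, x ≠ u → x ∈ holeSet A := by
    intro x hx hxu
    refine (mem_holeSet_or_mem_pebbleSet A x).resolve_right fun hp => ?_
    have h1 := (mem_pathSet_iff hT).1 ((⟨β, hβ, hx⟩ : x ∈ pathSet T u w))
    have h2 := hu_min x ⟨hp, hβB hx⟩
    have h3 := hT.connected.dist_triangle (u := x) (v := w) (w := v)
    exact hxu (eq_of_dist_eq_zero hT (by omega)).symm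
  obtain ⟨y, hy⟩ := A.surjective u
  have sβ := movePebble_spec β hβ A hβh y hy
  have hA1 : ∀ x, A x ∉ B → update A (movePebble β) x = A x := fun x hx =>
    (within_movePebble β).update_apply_of_notMem fun h => hx (hβB h)
  have sα := bringHole_spec α hα (update A (movePebble β)) h (by rw [hA1 _ (hv ▸ hvB), hv])
  refine ⟨sβ.1.append sα.1, ((within_movePebble β).mono (hβB.trans hBX)).append
    ((within_bringHole α).mono hαX), ?_, ?_, ?_⟩
  · rw [List.length_append, length_movePebble, length_bringHole, length_eq_dist hT hβ,
      length_eq_dist hT hα, huw]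
  · rw [update_append]
    set A1 := update A (movePebble β) with hA1def
    set A2 := update A1 (bringHole α) with hA2def
    have hwA2 : w ∈ holeSet A2 := ⟨h, sα.2⟩
    have off : ∀ x ∈ B, x ≠ w → (x ∈ pebbleSet A2 ↔ x ∈ pebbleSet A1) := by
      intro x hx hxw
      have hxα : x ∉ α.support := fun h => hxw (hαB x h hx)
      have : ∀ z, A2 z = x ↔ A1 z = x := by
        intro z
        constructor
        · intro hz
          rw [← hz]
          refine ((within_bringHole α).update_apply_of_notMem fun h => hxα ?_).symm
          rw [← hz]
          exact (within_bringHole α).update_apply_mem h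
        · intro hz
          rw [← hz]
          exact (within_bringHole α).update_apply_of_notMem (by rw [hz]; exact hxα)
      simp only [pebbleSet, Set.mem_range, this]
    ext x
    simp only [Set.mem_inter_iff, Set.mem_sdiff, Set.mem_singleton_iff]
    by_cases hxB : x ∈ B
    · by_cases hxw : x = w
      · subst hxw
        refine iff_of_false (fun hp => mem_holeSet_iff.1 hwA2 hp.1) ?_
        rintro ⟨hp, hne⟩
        exact mem_holeSet_iff.1 (hβh x β.end_mem_support hne) hp.1
      · rw [off x hxB hxw]
        by_cases hxβ : x ∈ β.support
        · refine iff_of_false (fun hp => mem_holeSet_iff.1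
            (holeSet_movePebble β hβ A hβh hxβ hxw) hp.1) ?_
          rintro ⟨hp, hne⟩
          exact mem_holeSet_iff.1 (hβh x hxβ hne) hp.1
        · have hxu : x ≠ u := fun h => hxβ (h ▸ β.start_mem_support)
          have : ∀ z, A1 z = x ↔ A z = x := by
            intro z
            constructor
            · intro hz
              rw [← hz]
              refine ((within_movePebble β).update_apply_of_notMem fun h => hxβ ?_).symm
              rw [← hz]
              exact (within_movePebble β).update_apply_mem h
            · intro hz
              rw [← hz]
              exact (within_movePebble β).update_apply_of_notMem (by rw [hz]; exact hxβ)
          simp only [pebbleSet, Set.mem_range, this]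
          tauto
    · tauto
  · intro x hx hxh
    rw [update_append]
    by_cases hxα : A x ∈ α.support
    · intro hB'
      have h1 : update (update A (movePebble β)) (bringHole α) x ∈ {x | x ∈ α.support} :=
        (within_bringHole α).update_apply_mem (by rw [hA1 x hx]; exact hxα)
      have h2 := hαB _ h1 hB'
      exact hxh (Equiv.injective _ (h2.trans sα.2.symm))
    · rw [(within_bringHole α).update_apply_of_notMem (by rw [hA1 x hx]; exact hxα), hA1 x hx]
      exact hx

/-- The loop invariant is that `VP` is the current set of pebble vertices of B and that the holes of
`Hb` lie in X outside B. Each round shrinks `VP` by one and costs a distance within X, which is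
below |X|. -/
theorem GatherLoop.spec [Finite V] (hT : T.IsTree) {B X : Set V} (hB : PathClosed T B)
    (hX : PathClosed T X) (hBX : B ⊆ X) {A A' : Config V P H} {Hb : Set H} {VP : Set V}
    {f : Plan T} (hg : GatherLoop T B A Hb VP f A') (hVP : VP = pebbleSet A ∩ B)
    (hHb : ∀ h ∈ Hb, A (Sum.inr h) ∉ B ∧ A (Sum.inr h) ∈ X) :
    Feasible A f ∧ A' = update A f ∧ Within X f ∧ B ⊆ holeSet A' ∧
      f.length ≤ VP.ncard * X.ncard := by
  induction hg with
  | done A Hb =>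
    refine ⟨feasible_nil A, rfl, within_nil X, fun x hx => ?_, by simp⟩
    refine mem_holeSet_iff.2 fun hp => ?_
    have : x ∈ (∅ : Set V) := hVP ▸ ⟨hp, hx⟩
    exact this
  | step A Hb VP h u v w β α f A' hh hv hu hu_min hw hw_min hβ hα rest ih =>
    subst hVP
    obtain ⟨h1, h2, h3, h4, h5⟩ := gather_iteration hT hB hX hBX β α hv (hv ▸ (hHb h hh).1)
      (hv ▸ (hHb h hh).2) hu hu_min hw hw_min hβ hα
    obtain ⟨i1, i2, i3, i4, i5⟩ := ih h4.symm (fun k hk =>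
      ⟨h5 _ (hHb k hk.1).1 (fun e => hk.2 (Sum.inr_injective e)),
        h2.update_apply_mem (hHb k hk.1).2⟩)
    refine ⟨h1.append i1, by rw [update_append]; exact i2, h2.append i3, i4, ?_⟩
    have h6 : T.dist u v < X.ncard := hX.dist_lt_ncard hT (hBX hu.2) (hv ▸ (hHb h hh).2)
    have h7 := Set.ncard_sdiff_singleton_add_one hu (Set.toFinite _)
    rw [List.length_append, h3, ← h7]
    linarith

theorem exists_gatherLoop [Finite V] [Finite H] (hT : T.IsTree) {B X : Set V}
    (hB : PathClosed T B)
    (hX : PathClosed T X) (hBX : B ⊆ X) (n : ℕ) (A : Config V P H) (Hb : Set H)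
    (hn : (pebbleSet A ∩ B).ncard = n)
    (hHb : ∀ h ∈ Hb, A (Sum.inr h) ∉ B ∧ A (Sum.inr h) ∈ X)
    (hcard : n ≤ Hb.ncard) :
    ∃ f A', GatherLoop T B A Hb (pebbleSet A ∩ B) f A' := by
  induction n generalizing A Hb with
  | zero =>
    rw [Set.ncard_eq_zero (Set.toFinite _)] at hn
    rw [hn]
    exact ⟨_, _, GatherLoop.done A Hb⟩
  | succ n ih =>
    obtain ⟨h, hh⟩ := Set.nonempty_of_ncard_ne_zero (s := Hb) (by omega)
    have hne : (pebbleSet A ∩ B).Nonempty := Set.nonempty_of_ncard_ne_zero (by omega)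
    obtain ⟨u, hu, hu_min⟩ := Set.exists_min_image (pebbleSet A ∩ B)
      (fun x => T.dist x (A (Sum.inr h))) (Set.toFinite _) hne
    obtain ⟨w, hw, hw_min⟩ := Set.exists_min_image (pathSet T u (A (Sum.inr h)) ∩ B)
      (fun x => T.dist x (A (Sum.inr h))) (Set.toFinite _) ⟨u, left_mem_pathSet hT _ _, hu.2⟩
    obtain ⟨β, hβ⟩ := exists_isPath hT u w
    obtain ⟨α, hα⟩ := exists_isPath hT w (A (Sum.inr h))
    obtain ⟨-, h2, -, h4, h5⟩ := gather_iteration hT hB hX hBX β α rfl (hHb h hh).1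
      (hHb h hh).2 hu hu_min hw hw_min hβ hα
    have h6 := Set.ncard_sdiff_singleton_add_one hu (Set.toFinite _)
    have h7 := Set.ncard_sdiff_singleton_add_one hh (Set.toFinite _)
    obtain ⟨f, A', hf⟩ := ih (update A (movePebble β ++ bringHole α)) (Hb \ {h})
      (by rw [h4]; omega) (fun k hk =>
      ⟨h5 _ (hHb k hk.1).1 (fun e => hk.2 (Sum.inr_injective e)),
        h2.update_apply_mem (hHb k hk.1).2⟩) (by omega)
    rw [h4] at hf
    exact ⟨_, _, GatherLoop.step A Hb _ h u _ w β α f A' hh rfl hu hu_min hw hw_min hβ hα hf⟩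

theorem Gather.spec [Finite V] (hT : T.IsTree) {B X : Set V} (hB : PathClosed T B)
    (hX : PathClosed T X) (hBX : B ⊆ X) {A A' : Config V P H} {f : Plan T}
    (hg : Gather T X B A f A') :
    Feasible A f ∧ A' = update A f ∧ Within X f ∧ B ⊆ holeSet A' ∧
      f.length ≤ B.ncard * X.ncard := by
  obtain ⟨M, hM, hg⟩ := hg
  obtain ⟨h1, h2, h3, h4, h5⟩ := hg.spec hT hB hX hBX rfl (fun h hh => ⟨hh.2, (hM.1.1 hh.1).2⟩)
  exact ⟨h1, h2, h3, h4, h5.trans (Nat.mul_le_mul_right _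
    (Set.ncard_le_ncard Set.inter_subset_right (Set.toFinite _)))⟩

/-- A closest set M contains every hole already in B. As |M| = |B|, the holes of M outside B are
then at least as many as the pebbles of B, so the loop never runs out of holes. -/
theorem exists_gather [Finite V] [Finite H] (hT : T.IsTree) {B X : Set V} (hB : PathClosed T B)
    (hX : PathClosed T X) (hBX : B ⊆ X) (A : Config V P H)
    (hcard : B.ncard ≤ (holeSet A ∩ X).ncard) : ∃ f A', Gather T X B A f A' := by
  obtain ⟨M, hM⟩ := exists_isClosestSubset T B hcard
  -- A hole of B missing from M has distance 0 to B, and by cardinality M has an element outside B,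
  -- at positive distance. This contradicts the exchange property.
  have hMB : holeSet A ∩ B ⊆ M := by
    intro y hy
    by_contra hyM
    have : ∃ x ∈ M, x ∉ B := by
      by_contra hcon
      push Not at hcon
      have h1 : (M : Set V) ⊆ B \ {y} := fun x hx => ⟨hcon x hx, fun e => hyM (e ▸ hx)⟩
      have h2 := Set.ncard_le_ncard h1 (Set.toFinite _)
      have h3 := Set.ncard_sdiff_singleton_add_one hy.2 (Set.toFinite _)
      rw [Set.ncard_coe_finset, hM.1.2] at h2
      omega
    obtain ⟨x, hx, hxB⟩ := this
    have h1 := hM.le hx ⟨hy.1, hBX hy.2⟩ hyM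
    rw [distToSet_eq_zero hy.2] at h1
    have := distToSet_pos hT ⟨y, hy.2⟩ hxB
    omega
  have hc1 : (M : Set V).ncard = B.ncard := by rw [Set.ncard_coe_finset, hM.1.2]
  have hc2 : {h : H | A (Sum.inr h) ∈ M ∧ A (Sum.inr h) ∉ B}.ncard = ((M : Set V) \ B).ncard := by
    rw [← Set.ncard_image_of_injective _
      (show Function.Injective (fun h : H => A (Sum.inr h)) from
        A.injective.comp Sum.inr_injective)]
    congr 1
    ext y
    constructor
    · rintro ⟨h, hh, rfl⟩; exact hh
    · rintro ⟨hy, hyB⟩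
      obtain ⟨h, rfl⟩ := (hM.1.1 hy).1
      exact ⟨h, ⟨hy, hyB⟩, rfl⟩
  have hc3 := Set.ncard_inter_add_ncard_sdiff_eq_ncard (M : Set V) B (Set.toFinite _)
  have hc4 := Set.ncard_inter_add_ncard_sdiff_eq_ncard B (pebbleSet A) (Set.toFinite _)
  have hc5 : ((M : Set V) ∩ B).ncard ≤ (B \ pebbleSet A).ncard :=
    Set.ncard_le_ncard (fun x hx => ⟨hx.2, mem_holeSet_iff.1 (hM.1.1 hx.1).1⟩) (Set.toFinite _)
  rw [Set.inter_comm] at hc4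
  obtain ⟨f, A', hf⟩ := exists_gatherLoop hT hB hX hBX _ A
    {h : H | A (Sum.inr h) ∈ M ∧ A (Sum.inr h) ∉ B} rfl
    (fun h hh => ⟨hh.2, (hM.1.1 hh.1).2⟩) (by omega)
  exact ⟨f, A', M, hM, hf⟩

end GatherFacts

/-! ### Geometry of the caterpillar sets. -/

section CaterpillarFacts

set_option linter.unusedSectionVars false

variable {V : Type*} {T : SimpleGraph V}

theorem mem_pathSet_between (hT : T.IsTree) {r t x y z : V} (hx : x ∈ pathSet T r t)
    (hy : y ∈ pathSet T r t) (hxy : T.dist r x ≤ T.dist r y) (hz : z ∈ pathSet T x y) :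
    z ∈ pathSet T r t ∧ T.dist r x ≤ T.dist r z ∧ T.dist r z ≤ T.dist r y := by
  have hz' := pathClosed_pathSet hT r t x hx y hy hz
  have h1 := (mem_pathSet_iff hT).1 hz
  have h2 := dist_of_mem_pathSet hT hx hy hxy
  have h3 := T.dist_comm (u := x) (v := z)
  have h4 := T.dist_comm (u := y) (v := z)
  refine ⟨hz', ?_, ?_⟩
  · by_contra h
    have h5 := dist_of_mem_pathSet hT hz' hx (by omega)
    have h6 := dist_of_mem_pathSet hT hz' hy (by omega)
    omega
  · by_contra h
    have h5 := dist_of_mem_pathSet hT hx hz' (by omega)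
    have h6 := dist_of_mem_pathSet hT hy hz' (by omega)
    omega

theorem between_mem_pathSet (hT : T.IsTree) {r t x y z : V} (hx : x ∈ pathSet T r t)
    (hy : y ∈ pathSet T r t) (hz : z ∈ pathSet T r t) (hxz : T.dist r x ≤ T.dist r z)
    (hzy : T.dist r z ≤ T.dist r y) : z ∈ pathSet T x y := by
  have h1 := dist_of_mem_pathSet hT hx hz hxz
  have h2 := dist_of_mem_pathSet hT hz hy hzy
  have h3 := dist_of_mem_pathSet hT hx hy (hxz.trans hzy)
  rw [mem_pathSet_iff hT]
  omega

/-- The node `j_{k-1}`, with `j_{-1} = i_0`. -/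
def prevEnd (i j : ℕ → V) (k : ℕ) : V := if k = 0 then i 0 else j (k - 1)

variable {c : ℕ} {r t : V} {m : ℕ} {i j ℓ : ℕ → V}

/-- Along the path from r, the order is i_k ≤ j_{k-1} < i_{k+1} ≤ j_k, with j_k exactly c - 2 beyond
i_k. All later facts on the nodes come from these positions. -/
theorem IsCaterpillar.pos (hT : T.IsTree) (hc : IsCaterpillar T c r t m i j ℓ) {k : ℕ}
    (hk : k ≤ m) :
    i k ∈ pathSet T r t ∧ prevEnd i j k ∈ pathSet T r t ∧ 1 ≤ T.dist r (i k) ∧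
      T.dist r (i k) ≤ T.dist r (prevEnd i j k) ∧
      (k < m → j k ∈ pathSet T r t ∧ T.dist r (j k) + 2 = T.dist r (i k) + c ∧
        T.dist r (prevEnd i j k) ≤ T.dist r (j k) ∧
        T.dist r (prevEnd i j k) < T.dist r (i (k + 1)) ∧
        T.dist r (i (k + 1)) ≤ T.dist r (j k)) := by
  have hjk : ∀ k, k < m → i k ∈ pathSet T r t → j k ∈ pathSet T r t ∧
      T.dist r (j k) + 2 = T.dist r (i k) + c := by
    intro k hk hi
    obtain ⟨h1, h2, h3⟩ := hc.j_lt k hk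
    have h4 := pathClosed_pathSet hT r t _ hi t (right_mem_pathSet hT r t) h2
    refine ⟨h4, ?_⟩
    rw [mem_pathSet_iff hT] at h2 h4 hi
    omega
  have hsucc : ∀ k, k < m → prevEnd i j k ∈ pathSet T r t → j k ∈ pathSet T r t →
      T.dist r (prevEnd i j k) ≤ T.dist r (j k) → i (k + 1) ∈ pathSet T r t ∧
      T.dist r (prevEnd i j k) < T.dist r (i (k + 1)) ∧ T.dist r (i (k + 1)) ≤ T.dist r (j k) := by
    intro k hk hp hj hle
    obtain ⟨⟨h1, h2, -⟩, -⟩ := hc.i_succ k hk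
    obtain ⟨h3, h4, h5⟩ := mem_pathSet_between hT hp hj hle h1
    refine ⟨h3, lt_of_le_of_ne h4 fun h => h2 ?_, h5⟩
    exact (eq_of_mem_pathSet hT hp h3 h).symm
  induction k with
  | zero =>
    have h0 : prevEnd i j 0 = i 0 := rfl
    have hd := SimpleGraph.dist_eq_one_iff_adj.2 hc.i_zero.1
    refine ⟨hc.i_zero.2, hc.i_zero.2, hd.ge, le_rfl, fun hk => ?_⟩
    obtain ⟨h1, h2⟩ := hjk 0 hk hc.i_zero.2
    have h3 := (hc.j_lt 0 hk).2.2
    have h4 : T.dist r (prevEnd i j 0) ≤ T.dist r (j 0) := by rw [h0]; omega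
    exact ⟨h1, h2, h4, (hsucc 0 hk hc.i_zero.2 h1 h4).2⟩
  | succ k ih =>
    obtain ⟨h1, h2, h3, h4, h5⟩ := ih (by omega)
    obtain ⟨h6, h7, h8, h9, h10⟩ := h5 (by omega)
    have hp : prevEnd i j (k + 1) = j k := rfl
    have hi := (hsucc k (by omega) h2 h6 h8).1
    refine ⟨hi, by rwa [hp], by omega, by rw [hp]; omega, fun hk' => ?_⟩
    obtain ⟨e1, e2⟩ := hjk (k + 1) hk' hi
    have e3 : T.dist r (prevEnd i j (k + 1)) ≤ T.dist r (j (k + 1)) := by rw [hp]; omega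
    exact ⟨e1, e2, e3, (hsucc (k + 1) hk' (by rwa [hp]) e1 e3).2⟩

theorem IsCaterpillar.j_mem (hT : T.IsTree) (hc : IsCaterpillar T c r t m i j ℓ) {k : ℕ}
    (hk : k ≤ m) : j k ∈ pathSet T r t ∧ T.dist r (i k) ≤ T.dist r (j k) := by
  rcases hk.lt_or_eq with h | rfl
  · obtain ⟨-, -, -, h1, h2⟩ := hc.pos hT hk
    obtain ⟨h3, -, h4, -⟩ := h2 h
    exact ⟨h3, h1.trans h4⟩
  · rw [hc.j_last.2]
    refine ⟨right_mem_pathSet hT r t, ?_⟩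
    have := (mem_pathSet_iff hT).1 (hc.pos hT le_rfl).1
    omega

theorem IsCaterpillar.segment (hT : T.IsTree) (hc : IsCaterpillar T c r t m i j ℓ) {k : ℕ}
    (hk : k ≤ m) {x : V} (hx : x ∈ pathSet T (i k) (j k)) :
    x ∈ pathSet T r t ∧ T.dist r (i k) ≤ T.dist r x :=
  let h := mem_pathSet_between hT (hc.pos hT hk).1 (hc.j_mem hT hk).1 (hc.j_mem hT hk).2 hx
  ⟨h.1, h.2.1⟩

/-- The number of caterpillar sets is at most about `2 d(r, t) / c`. -/
theorem IsCaterpillar.mul_le (hT : T.IsTree) (hc : IsCaterpillar T c r t m i j ℓ) :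
    m * (c - 1) ≤ 2 * T.dist r t := by
  -- One phase replaces the pair (i_k, j_{k-1}) by (i_{k+1}, j_k). The first is at least one beyond
  -- j_{k-1} and the second is c - 2 beyond i_k, so the sum of the positions gains at least c - 1.
  have key : ∀ k, k ≤ m → k * (c - 1) ≤ T.dist r (i k) + T.dist r (prevEnd i j k) := by
    intro k
    induction k with
    | zero => simp
    | succ k ih =>
      intro hk
      have h1 := ih (by omega)
      obtain ⟨-, -, -, h3, h4⟩ := hc.pos hT (show k ≤ m by omega)
      obtain ⟨-, h5, h6, h7, h8⟩ := h4 (by omega)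
      have hp : prevEnd i j (k + 1) = j k := rfl
      rw [hp, Nat.succ_mul]
      omega
  have h := key m le_rfl
  obtain ⟨h1, h2, -⟩ := hc.pos hT le_rfl
  rw [mem_pathSet_iff hT] at h1 h2
  omega

theorem IsCaterpillar.three_le (hT : T.IsTree) (hc : IsCaterpillar T c r t m i j ℓ) (hm : 0 < m) :
    3 ≤ c := by
  obtain ⟨-, -, -, -, h⟩ := hc.pos hT (Nat.zero_le m)
  obtain ⟨-, h1, -, h2, h3⟩ := h hm
  have hp : prevEnd i j 0 = i 0 := rfl
  rw [hp] at h2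
  omega

theorem IsCaterpillar.i_succ_mem (hT : T.IsTree) (hc : IsCaterpillar T c r t m i j ℓ) {k : ℕ}
    (hk : k < m) : i (k + 1) ∈ pathSet T (i k) (j k) := by
  obtain ⟨h1, -, -, h2, h3⟩ := hc.pos hT hk.le
  obtain ⟨h4, -, -, h6, h7⟩ := h3 hk
  exact between_mem_pathSet hT h1 h4 (hc.pos hT (show k + 1 ≤ m from hk)).1 (by omega) h7

theorem IsCaterpillar.adj_l (hc : IsCaterpillar T c r t m i j ℓ) {k : ℕ}
    (hk : k ≤ m) : T.Adj (i k) (ℓ k) := by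
  cases k with
  | zero => rw [hc.l_zero]; exact hc.i_zero.1.symm
  | succ k => exact (hc.l_succ k hk).1

theorem IsCaterpillar.l_notMem_segment (hT : T.IsTree) (hc : IsCaterpillar T c r t m i j ℓ)
    {k k' : ℕ} (hk : k ≤ m) (hk' : k' ≤ m) : ℓ k ∉ pathSet T (i k') (j k') := by
  intro h
  obtain ⟨h1, h2⟩ := hc.segment hT hk' h
  have h3 := (hc.pos hT hk').2.2.1
  cases k with
  | zero => rw [hc.l_zero, SimpleGraph.dist_self] at h2; omega
  | succ k => exact (hc.l_succ k hk).2 h1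

/-- A node ℓ_{k+1} off the path is one step farther from i_k than i_{k+1} is. Being also a neighbour
of i_k would force i_k = i_{k+1}. -/
theorem IsCaterpillar.l_ne (hT : T.IsTree) (hc : IsCaterpillar T c r t m i j ℓ)
    {k : ℕ} (hk : k < m) : ℓ k ≠ ℓ (k + 1) := by
  intro h
  obtain ⟨h1, h2⟩ := hc.l_succ k hk
  have hi := hc.pos hT hk.le
  have hi' := hc.pos hT (show k + 1 ≤ m from hk)
  have h3 := (pathClosed_pathSet hT r t).dist_of_adj hT hi'.1 h1 h2 hi.1
  rw [← h, SimpleGraph.dist_eq_one_iff_adj.2 (hc.adj_l hk.le)] at h3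
  have h4 : i k = i (k + 1) := eq_of_dist_eq_zero hT (by omega)
  have h5 := hi.2.2.2.2 hk
  have h6 := hi.2.2.2.1
  rw [← h4] at h5
  omega

/-- The vertices of the caterpillar set `S_k` other than `ℓ_k`. -/
def catTail (T : SimpleGraph V) (m : ℕ) (i j ℓ : ℕ → V) (k : ℕ) : Set V :=
  pathSet T (i k) (j k) ∪ (if k < m then {ℓ (k + 1)} else ∅)

theorem catSet_eq (k : ℕ) : catSet T m i j ℓ k = catTail T m i j ℓ k ∪ {ℓ k} := by
  unfold catSet catTail
  split_ifs
  · rw [Set.union_right_comm]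
  · rw [Set.union_empty]

theorem IsCaterpillar.l_notMem_catTail (hT : T.IsTree) (hc : IsCaterpillar T c r t m i j ℓ)
    {k : ℕ} (hk : k ≤ m) : ℓ k ∉ catTail T m i j ℓ k := by
  rintro (h | h)
  · exact hc.l_notMem_segment hT hk hk h
  · split_ifs at h with h'
    · exact hc.l_ne hT h' h
    · exact h

theorem IsCaterpillar.catSet_diff (hT : T.IsTree) (hc : IsCaterpillar T c r t m i j ℓ)
    {k : ℕ} (hk : k ≤ m) : catSet T m i j ℓ k \ {ℓ k} = catTail T m i j ℓ k := by
  rw [catSet_eq, Set.union_sdiff_right, Set.sdiff_singleton_eq_self (hc.l_notMem_catTail hT hk)]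

theorem i_mem_catTail (hT : T.IsTree) (k : ℕ) : i k ∈ catTail T m i j ℓ k :=
  Or.inl (left_mem_pathSet hT _ _)

theorem IsCaterpillar.pathClosed_catTail (hT : T.IsTree) (hc : IsCaterpillar T c r t m i j ℓ)
    {k : ℕ} : PathClosed T (catTail T m i j ℓ k) := by
  unfold catTail
  split_ifs with h
  · exact (pathClosed_pathSet hT _ _).union_singleton hT (hc.i_succ_mem hT h) (hc.l_succ k h).1
  · rw [Set.union_empty]; exact pathClosed_pathSet hT _ _

theorem IsCaterpillar.pathClosed_catSet (hT : T.IsTree) (hc : IsCaterpillar T c r t m i j ℓ)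
    {k : ℕ} (hk : k ≤ m) : PathClosed T (catSet T m i j ℓ k) := by
  rw [catSet_eq]
  exact (hc.pathClosed_catTail hT).union_singleton hT (i_mem_catTail hT k) (hc.adj_l hk)

theorem IsCaterpillar.ncard_catTail_le [Finite V] (hT : T.IsTree)
    (hc : IsCaterpillar T c r t m i j ℓ)
    {k : ℕ} (hk : k ≤ m) : (catTail T m i j ℓ k).ncard ≤ c := by
  unfold catTail
  refine (Set.ncard_union_le _ _).trans ?_
  rw [ncard_pathSet hT]
  rcases hk.lt_or_eq with h | rfl
  · rw [if_pos h, Set.ncard_singleton]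
    have := (hc.j_lt k h).2.2
    omega
  · rw [if_neg (lt_irrefl _), Set.ncard_empty, hc.j_last.2]
    exact hc.j_last.1

/-- The vertices of `S_k` other than `ℓ_{k+1}`, for `k < m`. -/
def catHead (T : SimpleGraph V) (i j ℓ : ℕ → V) (k : ℕ) : Set V :=
  pathSet T (i k) (j k) ∪ {ℓ k}

/-- The segment has c - 1 vertices and ℓ_k is one more. This is the exact supply of holes for the
next gathering, whose demand is bounded by `IsCaterpillar.ncard_catTail_le`. -/
theorem IsCaterpillar.ncard_catHead [Finite V] (hT : T.IsTree)
    (hc : IsCaterpillar T c r t m i j ℓ)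
    {k : ℕ} (hk : k < m) : (catHead T i j ℓ k).ncard = c := by
  unfold catHead
  rw [Set.union_singleton, Set.ncard_insert_of_notMem (hc.l_notMem_segment hT hk.le hk.le)
    (Set.toFinite _), ncard_pathSet hT]
  exact (hc.j_lt k hk).2.2

theorem IsCaterpillar.pathClosed_catHead_union (hT : T.IsTree)
    (hc : IsCaterpillar T c r t m i j ℓ) {k : ℕ} (hk : k < m) :
    PathClosed T (catHead T i j ℓ k ∪ catTail T m i j ℓ (k + 1)) :=
  ((pathClosed_pathSet hT _ _).union_singleton hT (left_mem_pathSet hT _ _)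
    (hc.adj_l hk.le)).union hT (hc.pathClosed_catTail hT) (Or.inl (hc.i_succ_mem hT hk))
    (i_mem_catTail hT _)

theorem IsCaterpillar.l_succ_notMem (hT : T.IsTree)
    (hc : IsCaterpillar T c r t m i j ℓ) {k : ℕ} (hk : k < m) :
    ℓ (k + 1) ∉ catHead T i j ℓ k ∪ catTail T m i j ℓ (k + 1) := by
  rintro ((h | h) | h)
  · exact hc.l_notMem_segment hT hk hk.le h
  · exact hc.l_ne hT hk h.symm
  · exact hc.l_notMem_catTail hT hk h

theorem IsCaterpillar.catSet_union_diff (hT : T.IsTree)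
    (hc : IsCaterpillar T c r t m i j ℓ) {k : ℕ} (hk : k < m) :
    (catSet T m i j ℓ k ∪ catSet T m i j ℓ (k + 1)) \ {ℓ (k + 1)} =
      catHead T i j ℓ k ∪ catTail T m i j ℓ (k + 1) := by
  rw [← Set.sdiff_singleton_eq_self (hc.l_succ_notMem hT hk), catSet_eq (k + 1)]
  unfold catHead catSet
  rw [if_pos hk]
  ext x
  simp only [Set.mem_sdiff, Set.mem_union, Set.mem_singleton_iff]
  tauto

theorem IsCaterpillar.nextStop_mem (hT : T.IsTree) (hc : IsCaterpillar T c r t m i j ℓ)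
    {k : ℕ} (hk : k ≤ m) : nextStop t m ℓ k ∈ catTail T m i j ℓ k := by
  unfold nextStop catTail
  rcases hk.lt_or_eq with h | rfl
  · rw [if_pos h, if_pos h]; exact Or.inr rfl
  · rw [if_neg (lt_irrefl k)]
    left
    rw [if_neg (lt_irrefl k), hc.j_last.2]
    exact right_mem_pathSet hT _ _

theorem IsCaterpillar.catTail_zero_subset (hT : T.IsTree) (hc : IsCaterpillar T c r t m i j ℓ) :
    catTail T m i j ℓ 0 ⊆ branch T r t := by
  have h1 : PathClosed T (catTail T m i j ℓ 0 ∪ pathSet T (i 0) t) :=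
    (hc.pathClosed_catTail hT).union hT (pathClosed_pathSet hT _ _) (i_mem_catTail hT 0)
      (left_mem_pathSet hT _ _)
  refine Set.subset_union_left.trans (subset_branch hT h1 (Or.inr (right_mem_pathSet hT _ _)) ?_)
  rintro (h | h)
  · rw [← hc.l_zero] at h
    exact hc.l_notMem_catTail hT (Nat.zero_le m) h
  · have h2 := hc.i_zero.2
    have h3 := SimpleGraph.dist_eq_one_iff_adj.2 hc.i_zero.1
    rw [mem_pathSet_iff hT] at h h2
    have h4 := T.dist_comm (u := r) (v := i 0)
    omega

end CaterpillarFacts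

/-! ### Procedure A: correctness, cost, and existence given a caterpillar. -/

section ProcAFacts

set_option linter.unusedSectionVars false

variable {V P H : Type*} [DecidableEq V] {T : SimpleGraph V}
variable {c : ℕ} {r t : V} {m : ℕ} {i j ℓ : ℕ → V}

/-- The route stays in the subtree S_k, all of which is free except the start. The final clause
recycles the holes: once the pebble is on ℓ_{k+1}, the rest of S_k is free. -/
theorem IsCaterpillar.slide [Finite V] (hT : T.IsTree) (hc : IsCaterpillar T c r t m i j ℓ) {k : ℕ}
    (hk : k ≤ m) {A : Config V P H} {p : P} (hp : A (Sum.inl p) = ℓ k)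
    (hh : catTail T m i j ℓ k ⊆ holeSet A) (β : T.Walk (ℓ k) (nextStop t m ℓ k)) (hβ : β.IsPath) :
    Feasible A (movePebble β) ∧ update A (movePebble β) (Sum.inl p) = nextStop t m ℓ k ∧
      (movePebble β).length ≤ c ∧
      (k < m → catHead T i j ℓ k ⊆ holeSet (update A (movePebble β))) := by
  have hS : ∀ x ∈ β.support, x ∈ catTail T m i j ℓ k ∪ {ℓ k} := by
    intro x hx
    have := hc.pathClosed_catSet hT hk (ℓ k) (by rw [catSet_eq]; exact Or.inr rfl)
      (nextStop t m ℓ k) (by rw [catSet_eq]; exact Or.inl (hc.nextStop_mem hT hk)) ⟨β, hβ, hx⟩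
    rwa [catSet_eq] at this
  have hβh : ∀ x ∈ β.support, x ≠ ℓ k → x ∈ holeSet A := fun x hx hne =>
    hh ((hS x hx).resolve_right hne)
  obtain ⟨h1, h2⟩ := movePebble_spec β hβ A hβh _ hp
  refine ⟨h1, h2, ?_, fun hkm x hx => ?_⟩
  · rw [length_movePebble, length_eq_dist hT hβ]
    have h3 := (hc.pathClosed_catSet hT hk).dist_lt_ncard hT (x := ℓ k) (y := nextStop t m ℓ k)
      (by rw [catSet_eq]; exact Or.inr rfl)
      (by rw [catSet_eq]; exact Or.inl (hc.nextStop_mem hT hk))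
    rw [catSet_eq] at h3
    have h4 := Set.ncard_union_le (catTail T m i j ℓ k) {ℓ k}
    rw [Set.ncard_singleton] at h4
    have h5 := hc.ncard_catTail_le hT hk
    omega
  · have hn : nextStop t m ℓ k = ℓ (k + 1) := if_pos hkm
    have hxn : x ≠ nextStop t m ℓ k := by
      rw [hn]
      rintro rfl
      exact hc.l_succ_notMem hT hkm (Or.inl hx)
    by_cases hxβ : x ∈ β.support
    · exact holeSet_movePebble β hβ A hβh hxβ hxn
    · have hx' : x ∈ catTail T m i j ℓ k := by
        rcases hx with h | h
        · exact Or.inl h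
        · exact absurd (h ▸ β.start_mem_support) hxβ
      obtain ⟨h, hx''⟩ := hh hx'
      refine ⟨h, ?_⟩
      simp only at hx'' ⊢
      rw [(within_movePebble β).update_apply_of_notMem (by rw [hx'']; exact hxβ), hx'']

/-- The gathering subtree avoids ℓ_{k+1}, so the parked pebble does not move. It has at most 2c
vertices, because it is the union of a head and a tail of at most c vertices each. -/
theorem IsCaterpillar.iteration [Finite V] (hT : T.IsTree) (hc : IsCaterpillar T c r t m i j ℓ)
    {k : ℕ} (hk : k < m) {A A' : Config V P H} {p : P} (hp : A (Sum.inl p) = nextStop t m ℓ k)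
    {g : Plan T} (hg : Gather T
        ((catSet T m i j ℓ k ∪ catSet T m i j ℓ (k + 1)) \ {ℓ (k + 1)})
        (catSet T m i j ℓ (k + 1) \ {ℓ (k + 1)}) A g A') :
    Feasible A g ∧ A' = update A g ∧ A' (Sum.inl p) = ℓ (k + 1) ∧
      catTail T m i j ℓ (k + 1) ⊆ holeSet A' ∧ g.length ≤ c * (2 * c) := by
  rw [hc.catSet_union_diff hT hk, hc.catSet_diff hT hk] at hg
  obtain ⟨h1, h2, h3, h4, h5⟩ := hg.spec hT (hc.pathClosed_catTail hT)
    (hc.pathClosed_catHead_union hT hk) Set.subset_union_right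
  have hn : nextStop t m ℓ k = ℓ (k + 1) := if_pos hk
  rw [hn] at hp
  refine ⟨h1, h2, ?_, h4, h5.trans (Nat.mul_le_mul (hc.ncard_catTail_le hT hk) ?_)⟩
  · rw [h2, h3.update_apply_of_notMem (by rw [hp]; exact hc.l_succ_notMem hT hk), hp]
  · refine (Set.ncard_union_le _ _).trans ?_
    have h6 := hc.ncard_catTail_le hT (show k + 1 ≤ m from hk)
    have h7 := hc.ncard_catHead hT hk
    omega

theorem SlideLoop.spec [Finite V] (hT : T.IsTree) (hc : IsCaterpillar T c r t m i j ℓ) {k : ℕ}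
    {A : Config V P H} {f : Plan T} (hs : SlideLoop T t m i j ℓ k A f) {p : P}
    (hp : A (Sum.inl p) = nextStop t m ℓ k) :
    Feasible A f ∧ update A f (Sum.inl p) = t ∧ f.length ≤ (m - k) * (c * (2 * c) + c) := by
  induction hs with
  | done A => exact ⟨feasible_nil A, hp.trans (if_neg (lt_irrefl _)), by simp⟩
  | step k A A' g f β hk gather hβ rest ih =>
    obtain ⟨h1, h2, h3, h4, h5⟩ := hc.iteration hT hk hp gather
    obtain ⟨i1, i2, i3, -⟩ := hc.slide hT hk h3 h4 β hβ
    obtain ⟨e1, e2, e3⟩ := ih i2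
    subst h2
    refine ⟨(h1.append i1).append (by rwa [update_append]), by rwa [update_append, update_append],
      ?_⟩
    rw [List.length_append, List.length_append, show m - k = (m - (k + 1)) + 1 by omega,
      Nat.succ_mul]
    omega

theorem exists_slideLoop [Finite V] [Finite H] (hT : T.IsTree)
    (hc : IsCaterpillar T c r t m i j ℓ)
    (n k : ℕ) (hn : k + n = m) (A : Config V P H) (p : P)
    (hp : A (Sum.inl p) = nextStop t m ℓ k)
    (hh : k < m → catHead T i j ℓ k ⊆ holeSet A) : ∃ f, SlideLoop T t m i j ℓ k A f := by
  induction n generalizing k A with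
  | zero => obtain rfl : k = m := by omega
            exact ⟨[], SlideLoop.done A⟩
  | succ n ih =>
    have hk : k < m := by omega
    have hg : ∃ g A', Gather T ((catSet T m i j ℓ k ∪ catSet T m i j ℓ (k + 1)) \ {ℓ (k + 1)})
        (catSet T m i j ℓ (k + 1) \ {ℓ (k + 1)}) A g A' := by
      rw [hc.catSet_union_diff hT hk, hc.catSet_diff hT hk]
      refine exists_gather hT (hc.pathClosed_catTail hT)
        (hc.pathClosed_catHead_union hT hk) Set.subset_union_right A ?_
      refine (hc.ncard_catTail_le hT hk).trans ?_
      rw [← hc.ncard_catHead hT hk]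
      exact Set.ncard_le_ncard (fun x hx => ⟨hh hk hx, Or.inl hx⟩) (Set.toFinite _)
    obtain ⟨g, A', hg⟩ := hg
    obtain ⟨h1, h2, h3, h4, h5⟩ := hc.iteration hT hk hp hg
    obtain ⟨β, hβ⟩ := exists_isPath hT (ℓ (k + 1)) (nextStop t m ℓ (k + 1))
    obtain ⟨i1, i2, i3, i4⟩ := hc.slide hT hk h3 h4 β hβ
    obtain ⟨f, hf⟩ := ih (k + 1) (by omega) _ i2 i4
    exact ⟨_, SlideLoop.step k A A' g f β hk hg hβ hf⟩

theorem IsCaterpillar.first [Finite V] (hT : T.IsTree) (hc : IsCaterpillar T c r t m i j ℓ)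
    {A A' : Config V P H} {p : P} (hp : A (Sum.inl p) = r) {g : Plan T}
    (hg : Gather T (branch T r t) (catSet T m i j ℓ 0 \ {ℓ 0}) A g A') :
    Feasible A g ∧ A' = update A g ∧ A' (Sum.inl p) = ℓ 0 ∧ catTail T m i j ℓ 0 ⊆ holeSet A' ∧
      g.length ≤ c * (branch T r t).ncard := by
  rw [hc.catSet_diff hT (Nat.zero_le m)] at hg
  obtain ⟨h1, h2, h3, h4, h5⟩ := hg.spec hT (hc.pathClosed_catTail hT)
    (pathClosed_branch hT r t) (hc.catTail_zero_subset hT)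
  refine ⟨h1, h2, ?_, h4, h5.trans (Nat.mul_le_mul_right _ (hc.ncard_catTail_le hT m.zero_le))⟩
  rw [h2, h3.update_apply_of_notMem (by rw [hp]; exact notMem_branch_self r t), hp, hc.l_zero]

theorem ProcA.spec [Fintype V] (hT : T.IsTree) {A : Config V P H} {f : Plan T}
    (h : ProcA T c r t A f) {p : P} (hp : A (Sum.inl p) = r) :
    Feasible A f ∧ update A f (Sum.inl p) = t ∧ f.length ≤ 14 * (Fintype.card V * c) := by
  obtain ⟨m, i, j, ℓ, g, f', A', β, hc, hg, hβ, hs, rfl⟩ := h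
  obtain ⟨h1, h2, h3, h4, h5⟩ := hc.first hT hp hg
  obtain ⟨i1, i2, i3, -⟩ := hc.slide hT m.zero_le h3 h4 β hβ
  obtain ⟨e1, e2, e3⟩ := hs.spec hT hc i2
  subst h2
  refine ⟨(h1.append i1).append (by rwa [update_append]), by rwa [update_append, update_append],
    ?_⟩
  rw [List.length_append, List.length_append]
  have hn := dist_lt_card hT r t
  have hb : (branch T r t).ncard ≤ Fintype.card V := by
    rw [← Nat.card_eq_fintype_card]; exact Set.ncard_le_card _
  have b1 : c * (branch T r t).ncard ≤ c * Fintype.card V := Nat.mul_le_mul_left _ hb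
  have b2 : c * 1 ≤ c * Fintype.card V := Nat.mul_le_mul_left _ (by omega)
  -- For m > 0, c ≥ 3 gives c ≤ 2(c - 1), so mc ≤ 4n by `mul_le`, and a phase costs at most 3c². The
  -- total 14 is 12 for the phases, 1 for the first gathering and 1 for the first slide.
  have b3 : (m - 0) * (c * (2 * c) + c) ≤ 12 * (c * Fintype.card V) := by
    rcases Nat.eq_zero_or_pos m with rfl | hm
    · simp
    · have hc3 := hc.three_le hT hm
      have hm2 := hc.mul_le hT
      have hm4 : m * c ≤ 4 * Fintype.card V := by
        have : m * c ≤ m * (2 * (c - 1)) := Nat.mul_le_mul_left _ (by omega)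
        have e : m * (2 * (c - 1)) = 2 * (m * (c - 1)) := by ring
        omega
      calc (m - 0) * (c * (2 * c) + c) ≤ m * (c * (2 * c) + c * c) := by
            rw [Nat.sub_zero]; gcongr; nlinarith
        _ = (m * c) * (3 * c) := by ring
        _ ≤ (4 * Fintype.card V) * (3 * c) := Nat.mul_le_mul_right _ hm4
        _ = _ := by ring
  have e : Fintype.card V * c = c * Fintype.card V := mul_comm _ _
  omega

theorem IsCaterpillar.exists_procA [Finite V] [Finite H] (hT : T.IsTree)
    (hc : IsCaterpillar T c r t m i j ℓ) {A : Config V P H} {p : P} (hp : A (Sum.inl p) = r)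
    (hcard : c ≤ (holeSet A ∩ branch T r t).ncard) : ∃ f, ProcA T c r t A f := by
  have hg : ∃ g A', Gather T (branch T r t) (catSet T m i j ℓ 0 \ {ℓ 0}) A g A' := by
    rw [hc.catSet_diff hT (Nat.zero_le m)]
    exact exists_gather hT (hc.pathClosed_catTail hT)
      (pathClosed_branch hT r t) (hc.catTail_zero_subset hT) A
      ((hc.ncard_catTail_le hT m.zero_le).trans hcard)
  obtain ⟨g, A', hg⟩ := hg
  obtain ⟨h1, h2, h3, h4, h5⟩ := hc.first hT hp hg
  obtain ⟨β, hβ⟩ := exists_isPath hT (ℓ 0) (nextStop t m ℓ 0)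
  obtain ⟨i1, i2, i3, i4⟩ := hc.slide hT m.zero_le h3 h4 β hβ
  obtain ⟨f, hf⟩ := exists_slideLoop hT hc m 0 (by omega) _ p i2 i4
  exact ⟨_, m, i, j, ℓ, g, f, A', β, hc, hg, hβ, hf, rfl⟩

end ProcAFacts

/-! ### Corridors and the existence of the next junction. -/

section Corridors

variable {V : Type*} {T : SimpleGraph V}

theorem two_le_deg [Finite V] (hT : T.IsTree) {r t x : V} (hx : x ∈ pathSet T r t) (hr : x ≠ r)
    (ht : x ≠ t) : 2 ≤ deg T x := by
  have h1 := (mem_pathSet_iff hT).1 hx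
  have h2 := hT.connected.pos_dist_of_ne hr
  have h3 := hT.connected.pos_dist_of_ne ht
  have h4 := T.dist_comm (u := x) (v := r)
  obtain ⟨y, hy, hyd⟩ := exists_mem_pathSet_dist_eq hT (show T.dist r x - 1 ≤ T.dist r t by omega)
  obtain ⟨z, hz, hzd⟩ := exists_mem_pathSet_dist_eq hT (show T.dist r x + 1 ≤ T.dist r t by omega)
  have hxy := dist_of_mem_pathSet hT hy hx (by omega)
  have hxz := dist_of_mem_pathSet hT hx hz (by omega)
  have hne : y ≠ z := by rintro rfl; omega
  rw [deg, ← Set.ncard_pair hne]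
  refine Set.ncard_le_ncard ?_ (Set.toFinite _)
  rintro w (rfl | rfl)
  · exact (SimpleGraph.dist_eq_one_iff_adj.1 (show T.dist w x = 1 by omega)).symm
  · exact SimpleGraph.dist_eq_one_iff_adj.1 (show T.dist x w = 1 by omega)

/-- Neighbours of x on the path are determined by their distance to r, which takes at most two
values, while a junction has at least three neighbours. -/
theorem exists_adj_notMem_pathSet (hT : T.IsTree) {r t x : V}
    (hj : IsJunction T x) : ∃ y, T.Adj x y ∧ y ∉ pathSet T r t := by
  by_contra hcon
  push Not at hcon
  have h1 : (T.neighborSet x).ncard ≤ ({T.dist r x - 1, T.dist r x + 1} : Set ℕ).ncard := by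
    refine Set.ncard_le_ncard_of_injOn (T.dist r) (fun y hy => ?_) (fun y hy z hz hyz => ?_)
      (Set.toFinite _)
    · rcases dist_adj_cases hT r hy with h | h
      · left; omega
      · right; exact h
    · exact eq_of_mem_pathSet hT (hcon y hy) (hcon z hz) hyz
  have h2 := Set.ncard_insert_le (T.dist r x - 1) ({T.dist r x + 1} : Set ℕ)
  rw [Set.ncard_singleton] at h2
  unfold IsJunction deg at hj
  omega

theorem dist_le_c1 [Fintype V] (hT : T.IsTree) {a b : V} (h : IsCorridor T a b) :
    T.dist a b ≤ c1 T := by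
  refine le_csSup ⟨Fintype.card V, ?_⟩ ⟨a, b, h, rfl⟩
  rintro d ⟨a, b, -, rfl⟩
  exact (dist_lt_card hT a b).le

theorem dist_le_c2 [Fintype V] (hT : T.IsTree) {a b : V} (h : IsCorridor T a b)
    (ha : IsJunction T a) (hb : IsJunction T b) : T.dist a b ≤ c2 T := by
  refine le_csSup ⟨Fintype.card V, ?_⟩ ⟨a, b, h, ha, hb, rfl⟩
  rintro d ⟨a, b, -, -, -, rfl⟩
  exact (dist_lt_card hT a b).le

/-- A longest extension works: if its end had degree two, one of the two neighbours would be farther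
from a and would prolong it. -/
theorem exists_extension [Finite V] (hT : T.IsTree) {a b : V} (hab : a ≠ b)
    (h : ∀ x ∈ pathSet T a b, x ≠ a → x ≠ b → deg T x = 2) :
    ∃ b', deg T b' ≠ 2 ∧ b ∈ pathSet T a b' ∧
      ∀ x ∈ pathSet T a b', x ≠ a → x ≠ b' → deg T x = 2 := by
  obtain ⟨b', ⟨hb, hdeg⟩, hmax⟩ := Set.exists_max_image
    {b' | b ∈ pathSet T a b' ∧ ∀ x ∈ pathSet T a b', x ≠ a → x ≠ b' → deg T x = 2}
    (fun x => T.dist a x) (Set.toFinite _) ⟨b, right_mem_pathSet hT a b, h⟩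
  refine ⟨b', fun h2 => ?_, hb, hdeg⟩
  have h1 := (mem_pathSet_iff hT).1 hb
  have h0 := hT.connected.pos_dist_of_ne hab
  have hy : ∃ y, T.Adj b' y ∧ T.dist a y = T.dist a b' + 1 := by
    by_contra hcon
    push Not at hcon
    have key : ∀ y ∈ T.neighborSet b', y ∈ pathSet T a b' ∧ T.dist a y + 1 = T.dist a b' := by
      intro y hy
      have h3 := (dist_adj_cases hT a hy).resolve_right (hcon y hy)
      have h4 : T.dist y b' = 1 := SimpleGraph.dist_eq_one_iff_adj.2 (SimpleGraph.Adj.symm hy)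
      exact ⟨(mem_pathSet_iff hT).2 (by omega), h3.symm⟩
    have : (T.neighborSet b').ncard ≤ 1 := by
      rw [Set.ncard_le_one (Set.toFinite _)]
      intro y hy z hz
      have h5 := key y hy
      have h6 := key z hz
      exact eq_of_mem_pathSet hT h5.1 h6.1 (by omega)
    unfold deg at h2
    omega
  obtain ⟨y, hadj, hy⟩ := hy
  have h3 : T.dist b' y = 1 := SimpleGraph.dist_eq_one_iff_adj.2 hadj
  have h4 := hT.connected.dist_triangle (u := b) (v := b') (w := y)
  have h5 := hT.connected.dist_triangle (u := a) (v := b) (w := y)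
  have := hmax y ⟨(mem_pathSet_iff hT).2 (by omega), fun x hx hxa hxy => ?_⟩
  · omega
  · rcases pathSet_subset_union hT a y b' hx with hx | hx
    · by_cases hxb : x = b'
      · rw [hxb, h2]
      · exact hdeg x hx hxa hxb
    · rw [pathSet_adj hT hadj] at hx
      rw [hx.resolve_right hxy, h2]

/-- Extending at both ends turns the path into a corridor at least as long, so the degrees of a and
b do not matter. -/
theorem dist_le_c1_of_internal [Fintype V] (hT : T.IsTree) {a b : V}
    (h : ∀ x ∈ pathSet T a b, x ≠ a → x ≠ b → deg T x = 2) : T.dist a b ≤ c1 T := by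
  by_cases hab : a = b
  · subst hab; simp
  obtain ⟨b', h1, h2, h3⟩ := exists_extension hT hab h
  have hab' : b' ≠ a := by
    rintro rfl
    exact hab (((mem_pathSet_self hT).1 h2).symm)
  obtain ⟨a', h4, h5, h6⟩ := exists_extension hT hab' (fun x hx hb ha =>
    h3 x (by rwa [pathSet_comm hT]) ha hb)
  refine le_trans ?_ (dist_le_c1 hT (a := b') (b := a') ⟨h1, h4, h6⟩)
  rw [mem_pathSet_iff hT] at h2 h5
  have := T.dist_comm (u := a) (v := b')
  omega

/-- This is where the value of c is used. Without a junction at offsets 1 to c - 2 from y, the nodes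
there have degree two, and some stretch of the path is too long to be part of an admissible
corridor. -/
theorem exists_junction [Fintype V] (hT : T.IsTree) {r t y : V} (hy : y ∈ pathSet T r t)
    (hy1 : 1 ≤ T.dist r y) (hyL : T.dist r y + corridorBound T ≤ T.dist r t)
    (hyj : T.dist r y = 1 ∨ IsJunction T y) :
    ∃ x ∈ pathSet T r t, IsJunction T x ∧ T.dist r y < T.dist r x ∧
      T.dist r x + 2 ≤ T.dist r y + corridorBound T := by
  by_contra hno
  push Not at hno
  have hdeg : ∀ z ∈ pathSet T r t, 1 ≤ T.dist r z → T.dist r z < T.dist r t → ¬ IsJunction T z →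
      deg T z = 2 := by
    intro z hz h1 h2 h3
    have h4 := two_le_deg hT hz (by rintro rfl; simp at h1) (by rintro rfl; simp at h2)
    unfold IsJunction at h3
    omega
  by_cases hpg : IsPathGraph T
  · have hc : corridorBound T = c1 T := if_pos hpg
    have := dist_le_c1_of_internal hT (a := r) (b := t) (fun x hx hr ht => by
      have h1 := two_le_deg hT hx hr ht
      rcases hpg.2 x with h | h <;> omega)
    omega
  have hc : corridorBound T = max (c1 T + 1) (c2 T + 2) := if_neg hpg
  have hc1 : c1 T + 1 ≤ corridorBound T := hc ▸ le_max_left _ _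
  have hc2 : c2 T + 2 ≤ corridorBound T := hc ▸ le_max_right _ _
  have between : ∀ z ∈ pathSet T r t, T.dist r y < T.dist r z →
      T.dist r z + 2 ≤ T.dist r y + corridorBound T → deg T z = 2 := fun z hz h1 h2 =>
    hdeg z hz (by omega) (by omega) fun h => absurd (hno z hz h h1) (by omega)
  by_cases hj : IsJunction T y
  -- Here z is at offset c - 1 from the junction y. If z is a junction, they bound a corridor longer
  -- than c₂. Otherwise z has degree two, and the stretch to offset c is longer than c₁.
  · obtain ⟨z, hz, hzd⟩ := exists_mem_pathSet_dist_eq hT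
      (show T.dist r y + corridorBound T - 1 ≤ T.dist r t by omega)
    have hyz := dist_of_mem_pathSet hT hy hz (by omega)
    have hint : ∀ x ∈ pathSet T y z, x ≠ y → x ≠ z → deg T x = 2 := by
      intro x hx hxy hxz
      obtain ⟨h1, h2, h3⟩ := mem_pathSet_between hT hy hz (by omega) hx
      have h4 : T.dist r y ≠ T.dist r x := fun h => hxy (eq_of_mem_pathSet hT hy h1 h).symm
      have h5 : T.dist r x ≠ T.dist r z := fun h => hxz (eq_of_mem_pathSet hT h1 hz h)
      exact between x h1 (by omega) (by omega)
    by_cases hzj : IsJunction T z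
    · have hj2 : deg T y ≠ 2 := by unfold IsJunction at hj; omega
      have hz2 : deg T z ≠ 2 := by unfold IsJunction at hzj; omega
      have := dist_le_c2 hT (a := y) (b := z) ⟨hj2, hz2, hint⟩ hj hzj
      omega
    · have hz2 := hdeg z hz (by omega) (by omega) hzj
      obtain ⟨w, hw, hwd⟩ := exists_mem_pathSet_dist_eq hT hyL
      have hyw := dist_of_mem_pathSet hT hy hw (by omega)
      have := dist_le_c1_of_internal hT (a := y) (b := w) (fun x hx hxy hxw => by
        obtain ⟨h1, h2, h3⟩ := mem_pathSet_between hT hy hw (by omega) hx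
        have h4 : T.dist r y ≠ T.dist r x := fun h => hxy (eq_of_mem_pathSet hT hy h1 h).symm
        have h5 : T.dist r x ≠ T.dist r w := fun h => hxw (eq_of_mem_pathSet hT h1 hw h)
        by_cases hxz : x = z
        · rw [hxz, hz2]
        · have h6 : T.dist r x ≠ T.dist r z := fun h => hxz (eq_of_mem_pathSet hT h1 hz h)
          exact between x h1 (by omega) (by omega))
      omega
  · have hy2 := hyj.resolve_right hj
    -- Now y is the neighbour of r and has degree two itself, so the stretch can be started at r:
    -- its length c exceeds c₁.
    obtain ⟨w, hw, hwd⟩ := exists_mem_pathSet_dist_eq hT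
      (show corridorBound T ≤ T.dist r t by omega)
    have := dist_le_c1_of_internal hT (a := r) (b := w) (fun x hx hxr hxw => by
      obtain ⟨h1, h2, h3⟩ := mem_pathSet_between hT (left_mem_pathSet hT r t) hw (by simp) hx
      have h4 := hT.connected.pos_dist_of_ne hxr
      have h4' := T.dist_comm (u := x) (v := r)
      have h5 : T.dist r x ≠ T.dist r w := fun h => hxw (eq_of_mem_pathSet hT h1 hw h)
      by_cases hxy : x = y
      · rw [hxy]
        exact hdeg y hy (by omega) (by omega) hj
      · have h6 : T.dist r x ≠ T.dist r y := fun h => hxy (eq_of_mem_pathSet hT h1 hy h)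
        exact between x h1 (by omega) (by omega))
    omega

end Corridors

/-! ### Construction of the caterpillar nodes. -/

section CaterpillarExistence

variable {V : Type*} {T : SimpleGraph V}

open Classical in
/-- The positions on the path from `r` to `t`, enumerated by `P`, of `i_k` and `j_{k-1}`. -/
noncomputable def catPositions (T : SimpleGraph V) (c : ℕ) (P : ℕ → V) : ℕ → ℕ × ℕ
  | 0 => (1, 1)
  | k + 1 =>
    let s := catPositions T c P k
    (Nat.findGreatest (fun x => s.2 < x ∧ IsJunction T (P x)) (s.1 + c - 2), s.1 + c - 2)

/-- The nodes are built as positions on the path. `exists_junction` only gives a junction beyond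
i_k, whereas one beyond j_{k-1} is needed. The gap is closed by the invariant that no junction lies
strictly after i_k and up to j_{k-1}, which holds because i_k was chosen as the last junction before
that end. -/
theorem exists_isCaterpillar [Fintype V] (hT : T.IsTree) {r t : V} (hrt : r ≠ t) :
    ∃ m i j ℓ, IsCaterpillar T (corridorBound T) r t m i j ℓ := by
  classical
  set c := corridorBound T with hc
  set L := T.dist r t with hL
  have hL1 : 0 < L := hT.connected.pos_dist_of_ne hrt
  have hP : ∀ k, ∃ x, k ≤ L → x ∈ pathSet T r t ∧ T.dist r x = k := by
    intro k
    by_cases hk : k ≤ L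
    · obtain ⟨x, hx⟩ := exists_mem_pathSet_dist_eq hT hk
      exact ⟨x, fun _ => hx⟩
    · exact ⟨r, fun h => absurd h hk⟩
  choose P hP using hP
  set α : ℕ → ℕ := fun k => (catPositions T c P k).1 with hα
  set b : ℕ → ℕ := fun k => (catPositions T c P k).2 with hb
  have hα0 : α 0 = 1 := rfl
  have hb0 : b 0 = 1 := rfl
  have hαs : ∀ k, α (k + 1) =
      Nat.findGreatest (fun x => b k < x ∧ IsJunction T (P x)) (α k + c - 2) := fun k => rfl
  have hbs : ∀ k, b (k + 1) = α k + c - 2 := fun k => rfl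
  have step : ∀ k, 1 ≤ α k → α k + c ≤ L → (α k = 1 ∨ IsJunction T (P (α k))) →
      (∀ x, α k < x → x ≤ b k → ¬ IsJunction T (P x)) →
      b k < α (k + 1) ∧ IsJunction T (P (α (k + 1))) ∧ α (k + 1) ≤ b (k + 1) ∧
        (∀ x, α (k + 1) < x → x ≤ b (k + 1) → b k < x → ¬ IsJunction T (P x)) ∧
        α (k + 1) + 2 ≤ α k + c := by
    intro k h1 h2 h3 h4
    obtain ⟨hy, hyd⟩ := hP (α k) (by omega)
    obtain ⟨x, hx, hxj, hx1, hx2⟩ := exists_junction hT hy (by omega) (by omega)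
      (by rwa [hyd])
    rw [hyd] at hx1 hx2
    have hPx : P (T.dist r x) = x :=
      eq_of_mem_pathSet hT (hP _ (by omega)).1 hx (hP _ (by omega)).2
    have hbx : b k < T.dist r x := by
      by_contra h
      exact h4 _ hx1 (by omega) (by rwa [hPx])
    -- The witness excludes the default value 0 of `Nat.findGreatest`. The greatest position is that
    -- of the junction closest to j_k.
    obtain ⟨e1, e2⟩ := Nat.findGreatest_spec (P := fun x => b k < x ∧ IsJunction T (P x))
      (show T.dist r x ≤ α k + c - 2 by omega) ⟨hbx, by rwa [hPx]⟩
    rw [← hαs] at e1 e2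
    have e3 : α (k + 1) ≤ α k + c - 2 := by rw [hαs]; exact Nat.findGreatest_le _
    refine ⟨e1, e2, by rw [hbs]; exact e3, fun z hz1 hz2 hz3 hz4 => ?_, by omega⟩
    rw [hαs] at hz1
    rw [hbs] at hz2
    exact Nat.findGreatest_is_greatest hz1 hz2 ⟨hz3, hz4⟩
  have inv : ∀ k, (∀ k' < k, α k' + c ≤ L) → 1 ≤ α k ∧ α k ≤ L ∧ k + 1 ≤ α k ∧ α k ≤ b k ∧
      (α k = 1 ∨ IsJunction T (P (α k))) ∧ (∀ x, α k < x → x ≤ b k → ¬ IsJunction T (P x)) := by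
    intro k
    induction k with
    | zero =>
      intro _
      refine ⟨hα0.ge, by omega, by omega, by omega, Or.inl hα0, fun x h1 h2 => by omega⟩
    | succ k ih =>
      intro hk
      obtain ⟨h1, h2, h2', h3, h4, h5⟩ := ih fun k' hk' => hk k' (by omega)
      have hkk := hk k (by omega)
      obtain ⟨e1, e2, e3, e4, e5⟩ := step k h1 hkk h4 h5
      exact ⟨by omega, by omega, by omega, e3, Or.inr e2,
        fun x hx1 hx2 => e4 x hx1 hx2 (by omega)⟩
  -- The positions grow by at least one per step (`k + 1 ≤ α k`), so they cannot stay within the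
  -- path for L + 1 steps.
  have hex : ∃ k, ¬ (α k + c ≤ L) := by
    by_contra hcon
    push Not at hcon
    have := inv L fun k _ => hcon k
    omega
  set m := Nat.find hex with hm
  have hm1 : ¬ (α m + c ≤ L) := Nat.find_spec hex
  have hm2 : ∀ k < m, α k + c ≤ L := fun k hk => not_not.1 (Nat.find_min hex hk)
  have inv' : ∀ k ≤ m, 1 ≤ α k ∧ α k ≤ L ∧ k + 1 ≤ α k ∧ α k ≤ b k ∧
      (α k = 1 ∨ IsJunction T (P (α k))) ∧ (∀ x, α k < x → x ≤ b k → ¬ IsJunction T (P x)) :=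
    fun k hk => inv k fun k' hk' => hm2 k' (by omega)
  have step' : ∀ k < m, _ := fun k hk =>
    step k (inv' k hk.le).1 (hm2 k hk) (inv' k hk.le).2.2.2.2.1 (inv' k hk.le).2.2.2.2.2
  have hℓ : ∀ k, ∃ y, k < m → T.Adj (P (α (k + 1))) y ∧ y ∉ pathSet T r t := by
    intro k
    by_cases hk : k < m
    · obtain ⟨y, hy⟩ := exists_adj_notMem_pathSet hT (r := r) (t := t) (step' k hk).2.1
      exact ⟨y, fun _ => hy⟩
    · exact ⟨r, fun h => absurd h hk⟩
  choose ℓ hℓ using hℓ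
  have ht := right_mem_pathSet hT r t
  refine ⟨m, fun k => P (α k), fun k => if k < m then P (α k + c - 2) else t,
    fun k => if k = 0 then r else ℓ (k - 1), ?_⟩
  constructor
  · rfl
  · obtain ⟨h1, h2⟩ := hP 1 hL1
    exact ⟨SimpleGraph.dist_eq_one_iff_adj.1 h2, h1⟩
  · intro k hk
    have hk' := hm2 k hk
    obtain ⟨e1, e2, e3, e4, e5⟩ := step' k hk
    have h1 := (inv' k hk.le).2.2.2.1
    obtain ⟨p1, p2⟩ := hP (α k) (by omega)
    obtain ⟨q1, q2⟩ := hP (α k + c - 2) (by omega)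
    have d1 := dist_of_mem_pathSet hT p1 ht (by omega)
    have d2 := dist_of_mem_pathSet hT p1 q1 (by omega)
    simp only [if_pos hk]
    exact ⟨by omega, between_mem_pathSet hT p1 ht q1 (by omega) (by omega), by omega⟩
  · obtain ⟨p1, p2⟩ := hP (α m) (inv' m le_rfl).2.1
    have d1 := dist_of_mem_pathSet hT p1 ht (by rw [p2]; exact (inv' m le_rfl).2.1)
    refine ⟨?_, if_neg (lt_irrefl m)⟩
    omega
  · intro k hk
    have hk' := hm2 k hk
    obtain ⟨e1, e2, e3, e4, e5⟩ := step' k hk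
    have h1 := (inv' k hk.le).2.2.2.1
    have hbk := hbs k
    obtain ⟨q1, q2⟩ := hP (α k + c - 2) (by omega)
    obtain ⟨p1, p2⟩ := hP (α (k + 1)) (by omega)
    obtain ⟨a1, a2⟩ := hP (b k) (by omega)
    have ha : (if k = 0 then P (α 0) else if k - 1 < m then P (α (k - 1) + c - 2) else t) =
        P (b k) := by
      cases k with
      | zero => rfl
      | succ k =>
        rw [if_neg (by omega), Nat.add_sub_cancel, if_pos (by omega), hbs]
    simp only [if_pos hk, ha]
    refine ⟨⟨between_mem_pathSet hT a1 q1 p1 (by omega) (by omega), ?_, e2⟩, ?_⟩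
    · intro h
      rw [h] at p2
      omega
    · rintro x ⟨hx1, hx2, hx3⟩
      obtain ⟨x1, x2, x3⟩ := mem_pathSet_between hT a1 q1 (by omega) hx1
      have hxb : T.dist r x ≠ T.dist r (P (b k)) := fun h => hx2 (eq_of_mem_pathSet hT x1 a1 h)
      have hPx : P (T.dist r x) = x :=
        eq_of_mem_pathSet hT (hP _ (by omega)).1 x1 (hP _ (by omega)).2
      have hle : T.dist r x ≤ α (k + 1) := by
        by_contra h
        exact e4 (T.dist r x) (by omega) (by omega) (by omega) (by rwa [hPx])
      have d1 := dist_of_mem_pathSet hT p1 q1 (by omega)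
      have d2 := dist_of_mem_pathSet hT x1 q1 (by omega)
      omega
  · intro k hk
    simpa using hℓ k hk

end CaterpillarExistence

/-! ### Branches at a vertex and sets closest to it. -/

section Branches

variable {V : Type*} {T : SimpleGraph V}

theorem mem_branch_of_mem_pathSet (hT : T.IsTree) {s x y : V} (hy : y ∈ pathSet T x s)
    (hys : y ≠ s) : y ∈ branch T s x := by
  rw [mem_branch_iff hT]
  intro h
  rw [mem_pathSet_iff hT] at h hy
  have h1 := T.dist_comm (u := x) (v := y)
  have h2 := T.dist_comm (u := x) (v := s)
  exact hys (eq_of_dist_eq_zero hT (by omega))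

theorem disjoint_branch {s a b : V} (ha : a ≠ s) (hab : a ∉ branch T s b) :
    Disjoint (branch T s a) (branch T s b) := by
  rw [Set.disjoint_left]
  intro x hxa hxb
  rw [← branch_eq_of_mem hxb, branch_eq_of_mem hxa] at hab
  exact hab (self_mem_branch ha)

theorem notMem_branch_of_adj (hT : T.IsTree) {s a b : V} (ha : T.Adj s a) (hb : T.Adj s b)
    (hab : a ≠ b) : a ∉ branch T s b := by
  rw [mem_branch_iff hT, not_not, mem_pathSet_iff hT]
  have h1 : T.dist a s = 1 := SimpleGraph.dist_eq_one_iff_adj.2 ha.symm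
  have h2 : T.dist s b = 1 := SimpleGraph.dist_eq_one_iff_adj.2 hb
  have h3 := hT.connected.pos_dist_of_ne hab
  rcases dist_adj_cases hT a hb with h | h <;> omega

theorem exists_adj_mem_branch (hT : T.IsTree) {s x : V} (hx : x ≠ s) :
    ∃ z, T.Adj s z ∧ x ∈ branch T s z := by
  obtain ⟨z, hz, hzd⟩ := exists_mem_pathSet_dist_eq hT
    (show 1 ≤ T.dist s x from hT.connected.pos_dist_of_ne hx.symm)
  have hadj := SimpleGraph.dist_eq_one_iff_adj.1 hzd
  refine ⟨z, hadj, ?_⟩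
  rw [pathSet_comm hT] at hz
  rw [branch_eq_of_mem (mem_branch_of_mem_pathSet hT hz hadj.ne')]
  exact self_mem_branch hx

/-- A vertex between s and an element of K lies in the same branch and is strictly closer to s, so
leaving it out would violate the exchange property. -/
theorem IsClosestSubset.pathClosed_insert (hT : T.IsTree) {s z : V} {q : ℕ}
    {K : Finset V} (hK : IsClosestSubset T (branch T s z) q {s} K) :
    PathClosed T (insert s (K : Set V)) := by
  classical
  refine pathClosed_of_base hT s fun x hx y hy => ?_
  rcases hx with rfl | hx
  · exact Or.inl ((mem_pathSet_self hT).1 hy)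
  by_cases hys : y = s
  · exact Or.inl hys
  by_cases hyx : y = x
  · rw [hyx]; exact Or.inr hx
  right
  by_contra hyK
  have h1 : y ∈ branch T s z := by
    rw [← branch_eq_of_mem (hK.1.1 hx)]
    exact mem_branch_of_mem_pathSet hT (by rwa [pathSet_comm hT]) hys
  have h2 := hK.le hx h1 hyK
  rw [distToSet_singleton, distToSet_singleton] at h2
  rw [mem_pathSet_iff hT] at hy
  have h3 := T.dist_comm (u := s) (v := x)
  have h4 := T.dist_comm (u := s) (v := y)
  exact hyx (eq_of_dist_eq_zero hT (by omega))

theorem IsClosestSubset.pathClosed (hT : T.IsTree) {s z : V} {q : ℕ}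
    {K : Finset V} (hK : IsClosestSubset T (branch T s z) q {s} K) :
    PathClosed T (K : Set V) := by
  intro a ha b hb x hx
  refine (hK.pathClosed_insert hT a (Or.inr ha) b (Or.inr hb) hx).resolve_left ?_
  rintro rfl
  exact notMem_branch_self x z
    (pathClosed_branch hT x z a (hK.1.1 ha) b (hK.1.1 hb) hx)

/-- The union of the branches at `s` through the nodes of the list `zs`. -/
def branches (T : SimpleGraph V) (s : V) (zs : List V) : Set V := {x | ∃ z ∈ zs, x ∈ branch T s z}

theorem branches_cons (s z : V) (zs : List V) :
    branches T s (z :: zs) = branch T s z ∪ branches T s zs := by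
  ext x; simp [branches]

theorem notMem_branches (s : V) (zs : List V) : s ∉ branches T s zs := by
  rintro ⟨z, -, hz⟩
  exact notMem_branch_self s z hz

theorem disjoint_branch_branches (hT : T.IsTree) {s z : V} {zs : List V} (hz : T.Adj s z)
    (hzs : ∀ z ∈ zs, T.Adj s z) (hn : z ∉ zs) : Disjoint (branch T s z) (branches T s zs) := by
  rw [Set.disjoint_left]
  rintro x hx ⟨z', hz', hx'⟩
  exact (disjoint_branch hz.ne' (notMem_branch_of_adj hT hz (hzs z' hz')
    (fun h => hn (h ▸ hz')))).ne_of_mem hx hx' rfl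

end Branches

/-! ### Procedure B: correctness, cost and existence. -/

section ProcBFacts

set_option linter.unusedSectionVars false

variable {V P H : Type*} [DecidableEq V] {T : SimpleGraph V}

theorem ncard_inter_add_le [Finite V] {S Y Z W : Set V} (hYZ : Disjoint Y Z) (hY : Y ⊆ W)
    (hZ : Z ⊆ W) : (S ∩ Y).ncard + (S ∩ Z).ncard ≤ (S ∩ W).ncard := by
  rw [← Set.ncard_union_eq (hYZ.mono Set.inter_subset_right Set.inter_subset_right)
    (Set.toFinite _) (Set.toFinite _)]
  refine Set.ncard_le_ncard ?_ (Set.toFinite _)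
  rintro x (h | h)
  exacts [⟨h.1, hY h.2⟩, ⟨h.1, hZ h.2⟩]

theorem ncard_set_le_card [Fintype V] (B : Set V) : B.ncard ≤ Fintype.card V := by
  rw [← Nat.card_eq_fintype_card]; exact Set.ncard_le_card _

theorem gather_branch_spec [Fintype V] (hT : T.IsTree) {s z : V} {q : ℕ} {K : Finset V}
    (hK : IsClosestSubset T (branch T s z) q {s} K) {A A' : Config V P H} {g : Plan T}
    (hg : Gather T (branch T s z) ↑K A g A') :
    Feasible A g ∧ A' = update A g ∧ Within (branch T s z) g ∧ ↑K ⊆ holeSet A' ∧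
      g.length ≤ q * Fintype.card V := by
  obtain ⟨h1, h2, h3, h4, h5⟩ := hg.spec hT (hK.pathClosed hT) (pathClosed_branch hT s z) hK.1.1
  refine ⟨h1, h2, h3, h4, h5.trans ?_⟩
  rw [Set.ncard_coe_finset, hK.1.2]
  exact Nat.mul_le_mul_left _ (ncard_set_le_card _)

/-- The last clause counts holes in K and in the branches other than the one containing K, since
these are what will lie on the target side of the parking node. The positivity of `q'` ensures that
a parking node exists. -/
theorem BranchLoop.spec [Fintype V] (hT : T.IsTree) {s : V} {zs : List V} {q : ℕ}
    {A A' : Config V P H} {f : Plan T} {K : Finset V} (hb : BranchLoop T s zs q A f A' K)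
    (hzs : ∀ z ∈ zs, T.Adj s z) (hnd : zs.Nodup) :
    Feasible A f ∧ A' = update A f ∧ Within (branches T s zs) f ∧
      f.length ≤ q * Fintype.card V ∧ ↑K ⊆ holeSet A' ∧
      ∃ z ∈ zs, (∃ q', (0 < q → 0 < q') ∧ IsClosestSubset T (branch T s z) q' {s} K) ∧
        q ≤ (holeSet A' ∩ (↑K ∪ {x | ∃ z' ∈ zs, z' ≠ z ∧ x ∈ branch T s z'})).ncard := by
  induction hb with
  | more z zs q qj A A₁ A₂ g f Hj K hqj hlt hHj gather rest ih =>
    rw [List.nodup_cons] at hnd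
    have hz : T.Adj s z := hzs z (by simp)
    have hzs' : ∀ z ∈ zs, T.Adj s z := fun z hz => hzs z (by simp [hz])
    obtain ⟨h1, h2, h3, h4, h5⟩ := gather_branch_spec hT hHj gather
    obtain ⟨i1, i2, i3, i4, i5, w, hw, ⟨q', hq', hK⟩, i6⟩ := ih hzs' hnd.2
    have hdisj := disjoint_branch_branches hT hz hzs' hnd.1
    subst h2
    refine ⟨h1.append i1, by rw [update_append]; exact i2, ?_, ?_, i5, w, by simp [hw],
      ⟨q', fun _ => hq' (by omega), hK⟩, ?_⟩
    · rw [branches_cons]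
      exact (h3.mono Set.subset_union_left).append (i3.mono Set.subset_union_right)
    · rw [List.length_append]
      have : q * Fintype.card V = qj * Fintype.card V + (q - qj) * Fintype.card V := by
        rw [← Nat.add_mul]; congr 1; omega
      omega
    -- The gathering in this branch only permutes its occupants, and the later ones take place in
    -- branches disjoint from it.
    · have e1 : (holeSet A₂ ∩ branch T s z).ncard = qj := by
        rw [hqj, i2]
        rw [ncard_holeSet_inter_congr (A := update A g)
          (fun x => i3.update_apply_mem_iff_of_disjoint hdisj.symm)]
        exact ncard_holeSet_inter_congr fun x => h3.update_apply_mem_iff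
      have hsub : (↑K ∪ {x | ∃ z' ∈ zs, z' ≠ w ∧ x ∈ branch T s z'} : Set V) ⊆
          branches T s zs := by
        rintro x (hx | ⟨z', hz', -, hx⟩)
        exacts [⟨w, hw, hK.1.1 hx⟩, ⟨z', hz', hx⟩]
      have e2 := ncard_inter_add_le (S := holeSet A₂) (hdisj.mono_right hsub)
        (W := ↑K ∪ {x | ∃ z' ∈ z :: zs, z' ≠ w ∧ x ∈ branch T s z'})
        (fun x hx => Or.inr ⟨z, by simp, fun h => hnd.1 (h ▸ hw), hx⟩) (by
          rintro x (hx | ⟨z', hz', hne, hx⟩)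
          exacts [Or.inl hx, Or.inr ⟨z', by simp [hz'], hne, hx⟩])
      omega
  | last z zs q A A₁ g Hj hle hHj gather =>
    obtain ⟨h1, h2, h3, h4, h5⟩ := gather_branch_spec hT hHj gather
    refine ⟨h1, h2, ?_, h5, h4, z, by simp, ⟨q, id, hHj⟩, ?_⟩
    · rw [branches_cons]
      exact h3.mono Set.subset_union_left
    · rw [← hHj.1.2, ← Set.ncard_coe_finset]
      exact Set.ncard_le_ncard (fun x hx => ⟨h4 hx, Or.inl hx⟩) (Set.toFinite _)

theorem exists_branchLoop [Fintype V] [Finite H] (hT : T.IsTree) {s : V} (zs : List V) (q : ℕ)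
    (A : Config V P H) (hzs : ∀ z ∈ zs, T.Adj s z) (hnd : zs.Nodup) (hq : 0 < q)
    (hcard : q ≤ (holeSet A ∩ branches T s zs).ncard) :
    ∃ f A' K, BranchLoop T s zs q A f A' K := by
  induction zs generalizing q A with
  | nil => simp [branches] at hcard; omega
  | cons z zs ih =>
    rw [List.nodup_cons] at hnd
    have hz : T.Adj s z := hzs z (by simp)
    have hzs' : ∀ z ∈ zs, T.Adj s z := fun z hz => hzs z (by simp [hz])
    have hdisj := disjoint_branch_branches hT hz hzs' hnd.1
    have hle : (holeSet A ∩ branch T s z).ncard ≤ (branch T s z).ncard :=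
      Set.ncard_le_ncard Set.inter_subset_right (Set.toFinite _)
    have gather : ∀ q' ≤ (holeSet A ∩ branch T s z).ncard, ∃ K g A',
        IsClosestSubset T (branch T s z) q' {s} K ∧ Gather T (branch T s z) ↑K A g A' := by
      intro q' hq'
      obtain ⟨K, hK⟩ := exists_isClosestSubset T {s} (hq'.trans hle)
      obtain ⟨g, A', hg⟩ := exists_gather hT (hK.pathClosed hT) (pathClosed_branch hT s z)
        hK.1.1 A (by rw [Set.ncard_coe_finset, hK.1.2]; exact hq')
      exact ⟨K, g, A', hK, hg⟩
    by_cases hlt : (holeSet A ∩ branch T s z).ncard < q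
    · obtain ⟨Hj, g, A₁, hH, hg⟩ := gather _ le_rfl
      obtain ⟨-, h2, h3, -, -⟩ := gather_branch_spec hT hH hg
      obtain ⟨f, A', K, hf⟩ := ih (q - (holeSet A ∩ branch T s z).ncard) A₁ hzs' hnd.2
        (by omega) (by
          rw [h2, ncard_holeSet_inter_congr (A := A)
            (fun x => h3.update_apply_mem_iff_of_disjoint hdisj)]
          rw [branches_cons, Set.inter_union_distrib_left] at hcard
          have := Set.ncard_union_le (holeSet A ∩ branch T s z) (holeSet A ∩ branches T s zs)
          omega)
      exact ⟨_, _, _, BranchLoop.more z zs q _ A A₁ A' g f Hj K rfl hlt hH hg hf⟩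
    · obtain ⟨Hj, g, A₁, hH, hg⟩ := gather q (by omega)
      exact ⟨_, _, _, BranchLoop.last z zs q A A₁ g Hj (by omega) hH hg⟩

/-- Moving the marked pebble into the last cleared branch. -/
theorem move_into_branch (hT : T.IsTree) {s z v : V} {q : ℕ} {K : Finset V}
    (hK : IsClosestSubset T (branch T s z) q {s} K) {A : Config V P H} (hA : ↑K ⊆ holeSet A)
    (hv : v ∈ K) (β : T.Walk s v) (hβ : β.IsPath) {p : P} (hp : A (Sum.inl p) = s) :
    Feasible A (movePebble β) ∧ update A (movePebble β) (Sum.inl p) = v ∧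
      Within (insert s (K : Set V)) (movePebble β) := by
  have hS : ∀ x ∈ β.support, x ∈ insert s (K : Set V) := fun x hx =>
    hK.pathClosed_insert hT s (Or.inl rfl) v (Or.inr hv) ⟨β, hβ, hx⟩
  obtain ⟨h1, h2⟩ := movePebble_spec β hβ A
    (fun x hx hne => hA ((hS x hx).resolve_left hne)) _ hp
  exact ⟨h1, h2, (within_movePebble β).mono hS⟩

theorem ProcB.spec [Fintype V] (hT : T.IsTree) {c : ℕ} {s t : V} {A : Config V P H} {f : Plan T}
    (h : ProcB T c s t A f) (hc : 0 < c) {p : P} (hp : A (Sum.inl p) = s) :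
    Feasible A f ∧ update A f (Sum.inl p) = t ∧ f.length ≤ 16 * (Fintype.card V * c) := by
  obtain ⟨zs, g, f', A', K, v, β, hnd, hzs, hb, hv, hmax, hβ, hA, rfl⟩ := h
  obtain ⟨h1, h2, h3, h4, h5, z, hz, ⟨q', -, hK⟩, -⟩ := hb.spec hT (fun z hz => ((hzs z).1 hz).1) hnd
  subst h2
  have hps : update A g (Sum.inl p) = s := by
    rw [h3.update_apply_of_notMem (by rw [hp]; exact notMem_branches s zs), hp]
  obtain ⟨i1, i2, -⟩ := move_into_branch hT hK h5 hv β hβ hps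
  obtain ⟨e1, e2, e3⟩ := hA.spec hT i2
  refine ⟨(h1.append i1).append (by rwa [update_append]), by rwa [update_append, update_append],
    ?_⟩
  -- At most cn moves for the gatherings, fewer than n ≤ cn for parking the pebble, and 14cn for
  -- Procedure A.
  rw [List.length_append, List.length_append, length_movePebble, length_eq_dist hT hβ]
  have b1 := dist_lt_card hT s v
  have b2 : (c - (holeSet A ∩ branch T s t).ncard) * Fintype.card V ≤ c * Fintype.card V :=
    Nat.mul_le_mul_right _ (Nat.sub_le _ _)
  have b3 : 1 * Fintype.card V ≤ c * Fintype.card V := Nat.mul_le_mul_right _ hc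
  have e : Fintype.card V * c = c * Fintype.card V := mul_comm _ _
  omega

/-- The branches at s together contain every hole, as s carries the marked pebble, so the missing q
holes can be found. It remains to show that at least c holes face the target once the pebble is
parked on v. -/
theorem exists_procB [Fintype V] [Fintype H] (hT : T.IsTree) {s t : V} {A : Config V P H}
    (hst : s ≠ t) (hH : corridorBound T ≤ Fintype.card H) {p : P} (hp : A (Sum.inl p) = s)
    (hlt : (holeSet A ∩ branch T s t).ncard < corridorBound T) :
    ∃ f, ProcB T (corridorBound T) s t A f := by
  classical
  set c := corridorBound T with hc
  obtain ⟨zs, hnd, hzs⟩ : ∃ zs : List V, zs.Nodup ∧ ∀ z, z ∈ zs ↔ T.Adj s z ∧ z ∉ branch T s t :=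
    ⟨(Finset.univ.filter fun z => T.Adj s z ∧ z ∉ branch T s t).toList,
      Finset.nodup_toList _, by simp⟩
  have hzadj : ∀ z ∈ zs, T.Adj s z := fun z hz => ((hzs z).1 hz).1
  have hdisj : Disjoint (branches T s zs) (branch T s t) := by
    rw [Set.disjoint_left]
    rintro x ⟨z, hz, hx⟩ hx'
    exact (disjoint_branch (hzadj z hz).ne' ((hzs z).1 hz).2).ne_of_mem hx hx' rfl
  have hcover : ∀ x, x ≠ s → x ∈ branch T s t ∪ branches T s zs := by
    intro x hx
    obtain ⟨z, hz, hxz⟩ := exists_adj_mem_branch hT hx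
    by_cases hzt : z ∈ branch T s t
    · rw [branch_eq_of_mem hzt] at hxz; exact Or.inl hxz
    · exact Or.inr ⟨z, (hzs z).2 ⟨hz, hzt⟩, hxz⟩
  have hcard : Fintype.card H ≤ (holeSet A ∩ branch T s t).ncard +
      (holeSet A ∩ branches T s zs).ncard := by
    have h1 : (holeSet A).ncard = Fintype.card H := by
      have := ncard_holeSet_inter A Set.univ
      rw [Set.inter_univ] at this
      rw [this]
      simp [Set.ncard_univ]
    rw [← h1]
    refine le_trans (Set.ncard_le_ncard ?_ (Set.toFinite _)) (Set.ncard_union_le _ _)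
    intro x hx
    rw [← Set.inter_union_distrib_left]
    refine ⟨hx, hcover x ?_⟩
    rintro rfl
    exact mem_holeSet_iff.1 hx ⟨p, hp⟩
  obtain ⟨g, A', K, hb⟩ := exists_branchLoop hT zs (c - (holeSet A ∩ branch T s t).ncard) A
    hzadj hnd (by omega) (by omega)
  obtain ⟨h1, h2, h3, h4, h5, z, hz, ⟨q', hq', hK⟩, h6⟩ := hb.spec hT hzadj hnd
  obtain ⟨v, hv, hmax⟩ := K.exists_max_image (fun x => T.dist s x)
    (Finset.card_pos.1 (by rw [hK.1.2]; exact hq' (by omega)))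
  obtain ⟨β, hβ⟩ := exists_isPath hT s v
  have hps : A' (Sum.inl p) = s := by
    rw [h2, h3.update_apply_of_notMem (by rw [hp]; exact notMem_branches s zs), hp]
  obtain ⟨i1, i2, i3⟩ := move_into_branch hT hK h5 hv β hβ hps
  have hvz : v ∈ branch T s z := hK.1.1 hv
  have hvs : v ≠ s := by rintro rfl; exact notMem_branch_self _ _ hvz
  have hvt : v ∉ branch T s t := fun h => hdisj.ne_of_mem ⟨z, hz, hvz⟩ h rfl
  have hvst : v ∉ pathSet T s t := fun h =>
    hvt (mem_branch_of_mem_pathSet hT (by rwa [pathSet_comm hT]) hvs)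
  have hto : ∀ x, v ∉ pathSet T x s → x ∈ branch T v t := by
    intro x hx
    rw [mem_branch_iff hT]
    intro h
    exact (pathSet_subset_union hT x t s h).elim hx hvst
  set O : Set V := ↑K ∪ {x | ∃ z' ∈ zs, z' ≠ z ∧ x ∈ branch T s z'} with hO
  have hOsub : O ⊆ branches T s zs := by
    rintro x (hx | ⟨z', hz', -, hx⟩)
    exacts [⟨z, hz, hK.1.1 hx⟩, ⟨z', hz', hx⟩]
  have c1 : (holeSet A' ∩ branch T s t).ncard = (holeSet A ∩ branch T s t).ncard := by
    rw [h2]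
    exact ncard_holeSet_inter_congr fun x => h3.update_apply_mem_iff_of_disjoint hdisj
  have c2 := ncard_inter_add_le (S := holeSet A') (hdisj.symm.mono_right hOsub)
    (W := insert s (branch T s t ∪ O)) (fun x hx => Or.inr (Or.inl hx))
    (fun x hx => Or.inr (Or.inr hx))
  -- The vertex s is included so that the parking route lies inside the set: the move then only
  -- permutes occupants of the set and keeps its number of holes.
  have c3 : (holeSet (update A' (movePebble β)) ∩ insert s (branch T s t ∪ O)).ncard =
      (holeSet A' ∩ insert s (branch T s t ∪ O)).ncard :=
    ncard_holeSet_inter_congr fun x => (i3.mono (S' := insert s (branch T s t ∪ O)) (by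
      rintro x (hx | hx)
      exacts [Or.inl hx, Or.inr (Or.inr (Or.inl hx))])).update_apply_mem_iff
  have c4 : (holeSet (update A' (movePebble β)) ∩ insert s (branch T s t ∪ O)).ncard ≤
      (holeSet (update A' (movePebble β)) ∩ branch T v t).ncard := by
    refine Set.ncard_le_ncard ?_ (Set.toFinite _)
    rintro x ⟨hx, hx'⟩
    have hxv : x ≠ v := by
      rintro rfl
      exact mem_holeSet_iff.1 hx ⟨p, i2⟩
    -- If v separated x from s, then x would lie in the branch of v, where the set contains only K.
    -- But x in K is at most as far from s as v, so x would equal v, which carries the pebble.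
    refine ⟨hx, hto x fun hvx => ?_⟩
    have hvb : v ∈ branch T s x := mem_branch_of_mem_pathSet hT hvx hvs
    rcases hx' with rfl | hx' | hx' | ⟨z', hz', hne, hx'⟩
    · exact hvs ((mem_pathSet_self hT).1 hvx)
    · rw [branch_eq_of_mem hx'] at hvb
      exact hvt hvb
    · have e1 := hmax x hx'
      rw [pathSet_comm hT, mem_pathSet_iff hT] at hvx
      exact hxv (eq_of_dist_eq_zero hT (by omega)).symm
    · rw [branch_eq_of_mem hx'] at hvb
      exact (disjoint_branch (hzadj z' hz').ne'
        (notMem_branch_of_adj hT (hzadj z' hz') (hzadj z hz) hne)).ne_of_mem hvb hvz rfl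
  have hvt' : v ≠ t := by
    rintro rfl
    exact hvst (right_mem_pathSet hT _ _)
  obtain ⟨m, i, j, ℓ, hcat⟩ := exists_isCaterpillar hT hvt'
  obtain ⟨f', hf'⟩ := hcat.exists_procA hT i2 (show c ≤ _ by omega)
  exact ⟨_, zs, g, f', A', K, v, β, hnd, hzs, hb, hv, hmax, hβ, hf', rfl⟩

end ProcBFacts

theorem Caterpillar.spec {V P H : Type*} [Fintype V] [DecidableEq V] {T : SimpleGraph V}
    (hT : T.IsTree) {A : Config V P H} {p : P} {t : V} {f : Plan T} (h : Caterpillar T p t A f) :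
    Feasible A f ∧ update A f (Sum.inl p) = t ∧
      f.length ≤ 16 * (Fintype.card V * corridorBound T) := by
  rcases h with ⟨h, rfl⟩ | ⟨-, h⟩ | ⟨hc, h⟩
  · exact ⟨feasible_nil A, h, Nat.zero_le _⟩
  · obtain ⟨h1, h2, h3⟩ := h.spec hT rfl
    exact ⟨h1, h2, by omega⟩
  · exact h.spec hT (Nat.zero_lt_of_lt hc.2) rfl

theorem exists_caterpillar {V P H : Type*} [Fintype V] [DecidableEq V] [Fintype H]
    {T : SimpleGraph V} (hT : T.IsTree) (A : Config V P H)
    (hH : corridorBound T ≤ Fintype.card H) (p : P) (t : V) : ∃ f, Caterpillar T p t A f := by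
  by_cases h : A (Sum.inl p) = t
  · exact ⟨[], Or.inl ⟨h, rfl⟩⟩
  by_cases hc : corridorBound T ≤ (holeSet A ∩ branch T (A (Sum.inl p)) t).ncard
  · obtain ⟨m, i, j, ℓ, hcat⟩ := exists_isCaterpillar hT h
    obtain ⟨f, hf⟩ := hcat.exists_procA hT (A := A) rfl hc
    exact ⟨f, Or.inr (Or.inl ⟨⟨h, hc⟩, hf⟩)⟩
  · obtain ⟨f, hf⟩ := exists_procB hT (A := A) h hH rfl (not_le.1 hc)
    exact ⟨f, Or.inr (Or.inr ⟨⟨h, not_le.1 hc⟩, hf⟩)⟩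

end PebbleMotion

theorem mainTheorem3 :
    ∃ C : ℕ, ∀ (V P H : Type*) [Fintype V] [DecidableEq V] [Fintype P] [Fintype H]
      (T : SimpleGraph V) (_hT : T.IsTree) (A : PebbleMotion.Config V P H)
      (_hH : PebbleMotion.corridorBound T ≤ Fintype.card H) (p : P) (t : V),
      (PebbleMotion.CaseB T (A (Sum.inl p)) t A →
        (∃ f, PebbleMotion.ProcB T (PebbleMotion.corridorBound T) (A (Sum.inl p)) t A f) ∧
        ∀ f, PebbleMotion.ProcB T (PebbleMotion.corridorBound T) (A (Sum.inl p)) t A f →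
          PebbleMotion.Solves A p t f ∧
            f.length ≤ C * (Fintype.card V * PebbleMotion.corridorBound T)) ∧
      (∃ f, PebbleMotion.Caterpillar T p t A f) ∧
      ∀ f, PebbleMotion.Caterpillar T p t A f →
        PebbleMotion.Solves A p t f ∧
          f.length ≤ C * (Fintype.card V * PebbleMotion.corridorBound T) := by
  refine ⟨16, fun V P H _ _ _ _ T hT A hH p t => ⟨fun hB => ⟨?_, fun f hf => ?_⟩, ?_,
    fun f hf => ?_⟩⟩
  · exact PebbleMotion.exists_procB hT hB.1 hH rfl hB.2
  · obtain ⟨h1, h2, h3⟩ := hf.spec hT (Nat.zero_lt_of_lt hB.2) rfl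
    exact ⟨⟨_, h1, h2⟩, h3⟩
  · exact PebbleMotion.exists_caterpillar hT A hH p t
  · obtain ⟨h1, h2, h3⟩ := hf.spec hT
    exact ⟨⟨_, h1, h2⟩, h3⟩
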